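/- \textbf{Proposition (Amplitude function).} Let $I=[a,b]\subseteq[-1,1]$ with $a<b$, and let $K,B$ be real constants. Let $n$ be sufficiently large and let $x_1,\dots,x_n\in[-1,1]$ be distinct points. Write $P(z)=\prod_{i=1}^n(z-x_i)$, let $\ell_k$ be the Lagrange basis polynomials of the nodes, let $\lambda(x)=\sum_{k=1}^n|\ell_k(x)|$ be the Lebesgue function, and assume $$\sup_{x\in I}\lambda(x)\le K n^{B}.$$ Put $\delta(x)=\min_i|x-x_i|$ and $U(z)=\frac1n\sum_{i=1}^n\log\frac1{|z-x_i|}$, and define $$\alpha=\frac1n\log\sum_{k=1}^n\frac1{|P'(x_k)|},\qquad \rho(x)=-\frac1{\pi^2}\int_{\mathbb R\setminus I}\frac{U(v)-\alpha}{(x-v)^2}\,dv\quad(x\in(a,b)),$$ $$A(x)=\sup_{x'\in I}|P(x')|\,e^{-n^{0.1}|x-x'|}\quad(x\in I).$$ Below, the constants implied in $O(\cdot)$, and how large $n$ must be, depend only on $I,K,B$; in statements involving an interval $I'=[a',b']$ with $a<a'<b'<b$ (written $O_{I'}$, $\asymp_{I'}$) they may depend on $I'$ as well. The quantities $\alpha$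 and $\rho$ satisfy $\alpha=O(1)$ and $$\delta(x)e^{-n\alpha}\le|P(x)|\le O(1)\,n^{O(1)}e^{-n\alpha}\quad(x\in I),$$ $$\rho(x)\asymp_{I'}1,\qquad \rho(x)-\rho(y)=O_{I'}(|x-y|)\quad(x,y\in I'),$$ $$U(x\pm i\eta)=\alpha-\pi\eta\rho(x)+O_{I'}\Big(\frac{\log n}{n}+\eta^3\Big)\quad\Big(x\in I',\ \eta\ge\frac{\log n}{n}\Big).$$ Moreover: \begin{itemize} \item[(i)] $|P(x)|\le A(x)$ for all $x\in I$. \item[(ii)] $e^{-n^{0.1}|x-y|}A(y)\le A(x)\le e^{n^{0.1}|x-y|}A(y)$ for all $x,y\in I$. \item[(iii)] $A(x)=n^{O(1)}e^{-n\alpha}$ for all $x\in I$; that is, $n^{-C}e^{-n\alpha}\le A(x)\le n^{C}e^{-n\alpha}$ with $C=O(1)$. \item[(iv)] For every $x\in I$ there is $x'\in I$ with $|x-x'|=O\big(\frac{\log n}{n^{0.1}}\big)$ and $$A(x)=|P(x')|e^{-n^{0.1}|x-x'|}=A(x')e^{-n^{0.1}|x-x'|}.$$ \item[(v)] If $x\in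 I'$ and $0\le\eta\le n^{-0.4}$, then $$|P(x+i\eta)|\le(1+O_{I'}(n^{-0.1}))\,A(x)\exp\big(\pi n\eta\rho(x)(1+O_{I'}(n^{-0.1}))\big).$$ If in addition $\eta\ge\frac{\log n}{n}$, then $$|P(x+i\eta)|=n^{O_{I'}(1)}A(x)\exp(\pi n\eta\rho(x)),$$ in the sense of two-sided bounds with factors $n^{-C}$ and $n^{C}$, where $C=O_{I'}(1)$. \item[(vi)] If $x\in I'$, then $|P'(x)|\le(1+O_{I'}(n^{-0.1}))\,\pi nA(x)\rho(x)$. \end{itemize} -/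

import Mathlib

noncomputable section

namespace LagrangeInterp

/-- The monic polynomial `P(z) = ∏ i, (z - x i)` whose roots are the nodes. -/
def nodePoly {n : ℕ} (x : Fin n → ℝ) : Polynomial ℝ :=
  Lagrange.nodal Finset.univ x

/-- The value `P(z)` at a complex point. -/
def nodePolyC {n : ℕ} (x : Fin n → ℝ) (z : ℂ) : ℂ :=
  Polynomial.aeval z (nodePoly x)

/-- The Lebesgue function `λ(t) = ∑ k, |ℓ_k(t)|` of Lagrange interpolation at the nodes. -/
def lebesgueFun {n : ℕ} (x : Fin n → ℝ) (t : ℝ) : ℝ :=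
  ∑ k, |(Lagrange.basis Finset.univ x k).eval t|

/-- The distance `δ(t) = min_i |t - x i|` from `t` to the nodes. -/
def nodeDist {n : ℕ} (x : Fin n → ℝ) (t : ℝ) : ℝ :=
  ⨅ i, |t - x i|

/-- The logarithmic potential `U(z) = (1/n) ∑ i, log (1 / |z - x i|)` of the empirical measure
`(1/n) ∑ i, δ_{x i}` of the nodes. -/
def logPotential {n : ℕ} (x : Fin n → ℝ) (z : ℂ) : ℝ :=
  (1 / (n : ℝ)) * ∑ i, Real.log (1 / ‖z - (x i : ℂ)‖)

/-- The constant `α = (1/n) log (∑ k, 1 / |P'(x k)|)`. -/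
def alpha {n : ℕ} (x : Fin n → ℝ) : ℝ :=
  (1 / (n : ℝ)) * Real.log (∑ k, 1 / |(nodePoly x).derivative.eval (x k)|)

/-- The density of states relative to the interval `I = [a, b]`, at a point `t` of its interior:
`ρ(t) = -(1/π²) ∫_{ℝ \ I} (U(v) - α) / (t - v)² dv`. -/
def rho {n : ℕ} (a b : ℝ) (x : Fin n → ℝ) (t : ℝ) : ℝ :=
  -(1 / Real.pi ^ 2) *
    ∫ v in (Set.Icc a b)ᶜ, (logPotential x (v : ℂ) - alpha x) / (t - v) ^ 2

/-- The amplitude `A(t) = sup_{s ∈ [a, b]} |P(s)| exp (-n^{0.1} |t - s|)`. -/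
def amplitude {n : ℕ} (a b : ℝ) (x : Fin n → ℝ) (t : ℝ) : ℝ :=
  ⨆ s : Set.Icc a b,
    |(nodePoly x).eval (s : ℝ)| * Real.exp (-((n : ℝ) ^ (0.1 : ℝ) * |t - (s : ℝ)|))

/-- The standing hypotheses: `x` consists of distinct nodes in `[-1, 1]` whose Lebesgue function is
at most `K * n ^ B` on `[a, b]`. -/
structure GoodNodes (a b K B : ℝ) {n : ℕ} (x : Fin n → ℝ) : Prop where
  injective : Function.Injective x
  mem_Icc : ∀ i, x i ∈ Set.Icc (-1 : ℝ) 1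
  lebesgue_le : ∀ t ∈ Set.Icc a b, lebesgueFun x t ≤ K * (n : ℝ) ^ B

end LagrangeInterp

end

namespace LagrangeInterp

open MeasureTheory Set Filter Topology Metric
open scoped Real

/-! Everything is read off from h = n(α − U) = log(|P| e^{nα}) on the real line (`normLog`). Since
|ℓ_k(t)| = |P(t)| / (|P'(x_k)| |t − x_k|), summing over k with |t − x_k| ≤ 2 gives |P| e^{nα} ≤ 2λ
on I, while Σ ℓ_k = 1 gives |P| e^{nα} ≥ δ on all of ℝ. So h ≤ O(log n) on I, and h ≥ −2 log n
everywhere except for logarithmic dips at the nodes whose total mass is 2/n. Globally h is only O(n)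
in L¹ of the weight 1/(1+v²).

Poisson's formula for each log|z − x_i| expresses h(t + iη) as the Poisson integral of h. For t in
I', the kernel outside I is η/(t−v)² up to O(η³/(1+v²)), so that part equals πnηρ(t) + O(nη³)
(`abs_sum_log_sub_le`). The part over I is O(log n) once η ≥ log n / n (`abs_innerPoisson_le`); this
yields the potential estimate and the two-sided bound in (v). Bounds for ρ use the same weight:
above by the L¹ bound, below because h ≥ n on a fixed window far to the right while its negative
part is negligible (`le_rho`).

The amplitude is a sup-convolution of |P|, hence log-Lipschitz. Therefore h(v) ≤ log(A(t)e^{nα}) +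
n^{0.1}|v−t| on I, and averaging against the Poisson kernel costs only n^{0.1}√η
(`innerPoisson_le`). As n^{0.1}√η ≤ n^{-0.1}(1+nη), this is the sharp upper bound in (v).

For (vi), (v) says that z ↦ P(t+z) has exponential type close to πnρ(t) on a disc of radius
n^{-1/2}. A local Bernstein inequality with constant 1 + O(1/m), m the number of half-periods in the
radius, is proved by residues of O(z)/(z² cos z), O being the odd part
(`norm_deriv_zero_le_of_le_exp_abs_im`). -/

/-! ### Poisson's formula for the logarithm. -/

lemma integrable_poisson_iff {t η : ℝ} (hη : 0 < η) (f : ℝ → ℝ) :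
    Integrable (fun v => η / ((v - t) ^ 2 + η ^ 2) * f v) ↔
      IntegrableOn (fun u => f (t + η * Real.tan u)) (Ioo (-(π / 2)) (π / 2)) := by
  have himg : (fun u => t + η * Real.tan u) '' Ioo (-(π / 2)) (π / 2) = univ := by
    refine eq_univ_of_forall fun v => ⟨Real.arctan ((v - t) / η), Real.arctan_mem_Ioo _, ?_⟩
    simp only [Real.tan_arctan]
    field_simp
    ring
  have hinj : InjOn (fun u => t + η * Real.tan u) (Ioo (-(π / 2)) (π / 2)) := by
    intro u hu v hv huv
    refine Real.injOn_tan hu hv ?_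
    have : η * Real.tan u = η * Real.tan v := by simpa using huv
    exact mul_left_cancel₀ hη.ne' this
  have hder : ∀ u ∈ Ioo (-(π / 2)) (π / 2), HasDerivWithinAt (fun u => t + η * Real.tan u)
      (η * (1 / Real.cos u ^ 2)) (Ioo (-(π / 2)) (π / 2)) u := fun u hu =>
    (((Real.hasDerivAt_tan (Real.cos_pos_of_mem_Ioo hu).ne').const_mul η).const_add
      t).hasDerivWithinAt
  rw [← integrableOn_univ, ← himg,
    integrableOn_image_iff_integrableOn_abs_deriv_smul measurableSet_Ioo hder hinj]
  refine integrableOn_congr_fun (fun u hu => ?_) measurableSet_Ioo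
  have hc := Real.cos_pos_of_mem_Ioo hu
  have h1 : (1 + Real.tan u ^ 2) = 1 / Real.cos u ^ 2 := by
    rw [← Real.inv_one_add_tan_sq hc.ne', one_div, inv_inv]
  rw [abs_of_pos (by positivity), smul_eq_mul, ← h1]
  have : 0 < 1 + Real.tan u ^ 2 := by positivity
  field_simp
  ring_nf

/-- The substitution v = t + η tan u sends Lebesgue measure on (−π/2, π/2) to the Poisson kernel
measure. -/
lemma integral_poisson_eq {t η : ℝ} (hη : 0 < η) (f : ℝ → ℝ) :
    ∫ v, η / ((v - t) ^ 2 + η ^ 2) * f v =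
      ∫ u in Ioo (-(π / 2)) (π / 2), f (t + η * Real.tan u) := by
  have himg : (fun u => t + η * Real.tan u) '' Ioo (-(π / 2)) (π / 2) = univ := by
    refine eq_univ_of_forall fun v => ⟨Real.arctan ((v - t) / η), Real.arctan_mem_Ioo _, ?_⟩
    simp only [Real.tan_arctan]
    field_simp
    ring
  have hinj : InjOn (fun u => t + η * Real.tan u) (Ioo (-(π / 2)) (π / 2)) := by
    intro u hu v hv huv
    refine Real.injOn_tan hu hv ?_
    have : η * Real.tan u = η * Real.tan v := by simpa using huv
    exact mul_left_cancel₀ hη.ne' this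
  have hder : ∀ u ∈ Ioo (-(π / 2)) (π / 2), HasDerivWithinAt (fun u => t + η * Real.tan u)
      (η * (1 / Real.cos u ^ 2)) (Ioo (-(π / 2)) (π / 2)) u := fun u hu =>
    (((Real.hasDerivAt_tan (Real.cos_pos_of_mem_Ioo hu).ne').const_mul η).const_add
      t).hasDerivWithinAt
  rw [← setIntegral_univ, ← himg,
    integral_image_eq_integral_abs_deriv_smul measurableSet_Ioo hder hinj]
  refine setIntegral_congr_fun measurableSet_Ioo (fun u hu => ?_)
  have hc := Real.cos_pos_of_mem_Ioo hu
  have h1 : (1 + Real.tan u ^ 2) = 1 / Real.cos u ^ 2 := by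
    rw [← Real.inv_one_add_tan_sq hc.ne', one_div, inv_inv]
  rw [abs_of_pos (by positivity), smul_eq_mul]
  rw [← h1]
  have : 0 < 1 + Real.tan u ^ 2 := by positivity
  field_simp
  ring_nf

lemma integrable_poisson {t η : ℝ} (hη : 0 < η) :
    Integrable (fun v => η / ((v - t) ^ 2 + η ^ 2)) := by
  have := (integrable_poisson_iff (t := t) hη (fun _ => 1)).2
    (integrableOn_const (by simp))
  simpa using this

lemma integral_poisson {t η : ℝ} (hη : 0 < η) :
    ∫ v, η / ((v - t) ^ 2 + η ^ 2) = π := by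
  have := integral_poisson_eq (t := t) hη (fun _ => 1)
  simp only [mul_one] at this
  rw [this]
  simp [Real.pi_pos.le]

lemma integrableOn_log_sin_add (c : ℝ) :
    IntegrableOn (fun u => Real.log (Real.sin (u + c))) (Ioo (-(π / 2)) (π / 2)) := by
  rw [← intervalIntegrable_iff_integrableOn_Ioo_of_le (by linarith [Real.pi_pos])]
  simpa using (intervalIntegrable_log_sin (a := -(π / 2) + c) (b := π / 2 + c)).comp_add_right c

/-- `Real.log` ignores signs, so log ∘ sin has period π and the integral over a full period does not
see the shift. -/
lemma integral_log_sin_add (c : ℝ) :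
    ∫ u in Ioo (-(π / 2)) (π / 2), Real.log (Real.sin (u + c)) = -(π * Real.log 2) := by
  rw [← integral_Ioc_eq_integral_Ioo,
    ← intervalIntegral.integral_of_le (by linarith [Real.pi_pos]),
    intervalIntegral.integral_comp_add_right (fun u => Real.log (Real.sin u))]
  have hper : Function.Periodic (fun u => Real.log (Real.sin u)) π := fun u => by
    simp [Real.sin_add_pi, Real.log_neg_eq_log]
  have h := hper.intervalIntegral_add_eq (-(π / 2) + c) 0
  rw [show -(π / 2) + c + π = π / 2 + c by ring, zero_add, integral_log_sin_zero_pi] at h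
  rw [h]; ring

/-- With z = s + iη one has s + η tan u = |z| cos(u − arg z) / cos u. Both cosines are shifted
sines, whose log-integrals over a period agree, so only log|z| survives integration. -/
lemma log_affine_tan_ae {s η : ℝ} (hη : 0 < η) :
    ∀ᵐ u ∂(volume.restrict (Ioo (-(π / 2)) (π / 2))),
      Real.log (s + η * Real.tan u) = Real.log ‖(s + η * Complex.I : ℂ)‖ +
        Real.log (Real.sin (u + (π / 2 - Complex.arg (s + η * Complex.I)))) -
        Real.log (Real.sin (u + π / 2)) := by
  set z : ℂ := s + η * Complex.I with hz
  -- The single zero of s + η tan u is discarded; there the logarithm of the product would not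
  -- split.
  have hne : ∀ᵐ u : ℝ ∂(volume.restrict (Ioo (-(π / 2)) (π / 2))),
      u ≠ Real.arctan (-s / η) := by
    rw [ae_iff]; simp
  filter_upwards [hne, ae_restrict_mem measurableSet_Ioo] with u hu hI
  have hc := Real.cos_pos_of_mem_Ioo hI
  have hzn : z ≠ 0 := by
    intro h
    have := congrArg Complex.im h
    simp [hz] at this
    exact hη.ne' this
  have hzp : 0 < ‖z‖ := norm_pos_iff.2 hzn
  have hre : ‖z‖ * Real.cos z.arg = s := by rw [Complex.norm_mul_cos_arg]; simp [hz]
  have him : ‖z‖ * Real.sin z.arg = η := by rw [Complex.norm_mul_sin_arg]; simp [hz]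
  have hkey : s + η * Real.tan u = ‖z‖ * Real.sin (u + (π / 2 - z.arg)) / Real.sin (u + π / 2) := by
    rw [Real.sin_add_pi_div_two, show u + (π / 2 - z.arg) = (u - z.arg) + π / 2 by ring,
      Real.sin_add_pi_div_two, Real.cos_sub, Real.tan_eq_sin_div_cos]
    field_simp
    rw [mul_add, ← mul_assoc, mul_comm ‖z‖ (Real.cos u), mul_assoc, hre, mul_comm (Real.sin u),
      ← mul_assoc, him]
    ring
  have h0 : s + η * Real.tan u ≠ 0 := by
    intro h
    apply hu
    rw [← Real.arctan_tan hI.1 hI.2]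
    congr 1
    field_simp
    linarith
  have h1 : Real.sin (u + π / 2) ≠ 0 := by rw [Real.sin_add_pi_div_two]; exact hc.ne'
  have h2 : Real.sin (u + (π / 2 - z.arg)) ≠ 0 := by
    intro h
    rw [hkey, h] at h0
    simp at h0
  rw [hkey, Real.log_div (mul_ne_zero hzp.ne' h2) h1, Real.log_mul hzp.ne' h2]

lemma integrableOn_log_affine_tan {s η : ℝ} (hη : 0 < η) :
    IntegrableOn (fun u => Real.log (s + η * Real.tan u)) (Ioo (-(π / 2)) (π / 2)) := by
  refine Integrable.congr ?_ (EventuallyEq.symm (log_affine_tan_ae (s := s) hη))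
  exact ((integrableOn_const (by simp)).add (integrableOn_log_sin_add _)).sub
    (integrableOn_log_sin_add _)

lemma setIntegral_log_affine_tan {s η : ℝ} (hη : 0 < η) :
    ∫ u in Ioo (-(π / 2)) (π / 2), Real.log (s + η * Real.tan u) =
      π * Real.log ‖(s + η * Complex.I : ℂ)‖ := by
  have hc : IntegrableOn (fun _ : ℝ => Real.log ‖(s + η * Complex.I : ℂ)‖)
    (Ioo (-(π / 2)) (π / 2)) := integrableOn_const (by simp)
  have hc' : IntegrableOn (fun u => Real.log ‖(s + η * Complex.I : ℂ)‖ +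
      Real.log (Real.sin (u + (π / 2 - Complex.arg (s + η * Complex.I)))))
      (Ioo (-(π / 2)) (π / 2)) := hc.add (integrableOn_log_sin_add _)
  rw [integral_congr_ae (log_affine_tan_ae (s := s) hη),
    integral_sub hc' (integrableOn_log_sin_add _),
    integral_add hc (integrableOn_log_sin_add _), integral_log_sin_add, integral_log_sin_add]
  simp [Real.pi_pos.le]

/-- Both log-sine terms are nonpositive, so flipping their signs dominates the absolute value by
something integrable in closed form. -/
lemma setIntegral_abs_log_affine_tan_le {s η : ℝ} (hη : 0 < η) :
    ∫ u in Ioo (-(π / 2)) (π / 2), |Real.log (s + η * Real.tan u)| ≤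
      π * |Real.log ‖(s + η * Complex.I : ℂ)‖| + 2 * (π * Real.log 2) := by
  set l := Real.log ‖(s + η * Complex.I : ℂ)‖ with hl
  have hc : IntegrableOn (fun _ : ℝ => |l|) (Ioo (-(π / 2)) (π / 2)) :=
    integrableOn_const (by simp)
  have hc' : IntegrableOn (fun u => |l| -
      Real.log (Real.sin (u + (π / 2 - Complex.arg (s + η * Complex.I)))))
      (Ioo (-(π / 2)) (π / 2)) := hc.sub (integrableOn_log_sin_add _)
  have hle : ∫ u in Ioo (-(π / 2)) (π / 2), |Real.log (s + η * Real.tan u)| ≤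
      ∫ u in Ioo (-(π / 2)) (π / 2), (|l| -
        Real.log (Real.sin (u + (π / 2 - Complex.arg (s + η * Complex.I)))) -
        Real.log (Real.sin (u + π / 2))) := by
    refine integral_mono_ae (integrableOn_log_affine_tan hη).abs
      (hc'.sub (integrableOn_log_sin_add _)) ?_
    filter_upwards [log_affine_tan_ae (s := s) hη] with u hu
    have hs : ∀ y : ℝ, Real.log (Real.sin y) ≤ 0 := fun y => by
      rw [← Real.log_abs]
      exact Real.log_nonpos (abs_nonneg _) (Real.abs_sin_le_one y)
    have h1 := hs (u + (π / 2 - Complex.arg (s + η * Complex.I)))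
    have h2 := hs (u + π / 2)
    rw [hu, ← hl]
    have h3 := neg_abs_le l
    have h4 := le_abs_self l
    exact abs_le.2 ⟨by linarith, by linarith⟩
  refine hle.trans (le_of_eq ?_)
  rw [integral_sub hc' (integrableOn_log_sin_add _),
    integral_sub hc (integrableOn_log_sin_add _), integral_log_sin_add, integral_log_sin_add]
  simp [Real.pi_pos.le]
  ring

/-- Poisson's formula in the upper half-plane for the logarithm of the distance to a real point. -/
lemma integrable_poisson_log {t η : ℝ} (hη : 0 < η) (y : ℝ) :
    Integrable (fun v => η / ((v - t) ^ 2 + η ^ 2) * Real.log (v - y)) := by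
  rw [integrable_poisson_iff hη]
  convert integrableOn_log_affine_tan (s := t - y) hη using 3
  ring

lemma integral_poisson_log {t η : ℝ} (hη : 0 < η) (y : ℝ) :
    ∫ v, η / ((v - t) ^ 2 + η ^ 2) * Real.log (v - y) =
      π * Real.log ‖(t + η * Complex.I - y : ℂ)‖ := by
  rw [integral_poisson_eq hη]
  have := setIntegral_log_affine_tan (s := t - y) hη
  push_cast at this
  rw [show (t + η * Complex.I - y : ℂ) = t - y + η * Complex.I by ring, ← this]
  congr 1; ext u; congr 1; ring

/-! ### The Cauchy weight and truncated logarithms. -/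

/-- The weight `1 / (1 + v²)`. -/
noncomputable def cauchyWeight (v : ℝ) : ℝ := 1 / (1 + v ^ 2)

lemma cauchyWeight_eq (v : ℝ) : cauchyWeight v = 1 / ((v - 0) ^ 2 + 1 ^ 2) := by
  unfold cauchyWeight; congr 1; ring

lemma cauchyWeight_pos (v : ℝ) : 0 < cauchyWeight v := by unfold cauchyWeight; positivity

lemma integrable_cauchyWeight : Integrable cauchyWeight := by
  simp_rw [funext cauchyWeight_eq]; exact integrable_poisson one_pos

lemma integral_cauchyWeight : ∫ v, cauchyWeight v = π := by
  simp_rw [cauchyWeight_eq]; exact integral_poisson one_pos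

lemma integrable_cauchyWeight_mul_log (y : ℝ) :
    Integrable (fun v => cauchyWeight v * Real.log (v - y)) := by
  simp_rw [cauchyWeight_eq]; exact integrable_poisson_log one_pos y

/-- The bound is uniform over possible node positions, so summing over nodes costs exactly a factor
n. -/
lemma integral_cauchyWeight_mul_abs_log_le {y : ℝ} (hy : |y| ≤ 1) :
    ∫ v, cauchyWeight v * |Real.log (v - y)| ≤ 3 * π := by
  simp_rw [cauchyWeight_eq]
  rw [integral_poisson_eq one_pos (fun v => |Real.log (v - y)|)]
  have h := setIntegral_abs_log_affine_tan_le (s := -y) one_pos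
  have h2 : ‖((-y : ℝ) + (1 : ℝ) * Complex.I : ℂ)‖ = √(y ^ 2 + 1) := by
    rw [Complex.norm_add_mul_I]; simp
  rw [h2, Real.log_sqrt (by positivity)] at h
  have h3 : Real.log (y ^ 2 + 1) ≤ Real.log 2 :=
    Real.log_le_log (by positivity) (by nlinarith [sq_abs y, abs_nonneg y])
  have h4 : 0 ≤ Real.log (y ^ 2 + 1) := Real.log_nonneg (by nlinarith)
  rw [abs_of_nonneg (by positivity)] at h
  have h5 := Real.log_two_lt_d9
  have heq : ∀ u : ℝ, 0 + 1 * Real.tan u - y = -y + 1 * Real.tan u := fun u => by ring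
  simp_rw [heq]
  refine h.trans ?_
  nlinarith [Real.pi_pos]

/-- The positive part of `log (r / |u|)`. -/
noncomputable def logCap (r u : ℝ) : ℝ := max (Real.log r - Real.log u) 0

lemma logCap_nonneg (r u : ℝ) : 0 ≤ logCap r u := le_max_right _ _

lemma logCap_eq_indicator {r : ℝ} (hr0 : 0 < r) (u : ℝ) (hu : u ≠ 0) :
    logCap r u = (Ioc (-r) r).indicator (fun u => Real.log r - Real.log u) u ∨ u = -r := by
  by_cases h : u ∈ Ioc (-r) r
  · left
    rw [indicator_of_mem h]
    refine max_eq_left (sub_nonneg.2 ?_)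
    rw [← Real.log_abs u]
    exact Real.log_le_log (abs_pos.2 hu) (abs_le.2 ⟨h.1.le, h.2⟩)
  · by_cases h' : u = -r
    · exact Or.inr h'
    left
    rw [indicator_of_notMem h]
    refine max_eq_right (sub_nonpos.2 ?_)
    rw [← Real.log_abs u]
    refine Real.log_le_log hr0 ?_
    rw [mem_Ioc, not_and_or, not_lt, not_le] at h
    rcases h with h | h
    · rw [abs_of_neg (by linarith)]; linarith
    · exact h.le.trans (le_abs_self u)

lemma logCap_ae_eq {r : ℝ} (hr0 : 0 < r) :
    logCap r =ᵐ[volume] (Ioc (-r) r).indicator (fun u => Real.log r - Real.log u) := by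
  have h1 : ∀ᵐ u : ℝ, u ≠ 0 := by rw [ae_iff]; simp
  have h2 : ∀ᵐ u : ℝ, u ≠ -r := by rw [ae_iff]; simp
  filter_upwards [h1, h2] with u hu hu'
  exact (logCap_eq_indicator hr0 u hu).resolve_right hu'

lemma integrable_logCap {r : ℝ} (hr0 : 0 < r) : Integrable (logCap r) := by
  refine Integrable.congr ?_ (logCap_ae_eq hr0).symm
  rw [integrable_indicator_iff measurableSet_Ioc,
    ← intervalIntegrable_iff_integrableOn_Ioc_of_le (by linarith)]
  exact intervalIntegrable_const.sub intervalIntegral.intervalIntegrable_log'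

lemma integral_logCap {r : ℝ} (hr0 : 0 < r) : ∫ u, logCap r u = 2 * r := by
  rw [integral_congr_ae (logCap_ae_eq hr0), integral_indicator measurableSet_Ioc,
    ← intervalIntegral.integral_of_le (by linarith),
    intervalIntegral.integral_sub intervalIntegrable_const
      intervalIntegral.intervalIntegrable_log', integral_log, Real.log_neg_eq_log]
  simp
  ring

/-! ### Residues and a local Bernstein inequality. -/

/-- The residue theorem on a disc for a quotient whose denominator has only simple zeros. -/
lemma circleIntegral_div_eq_sum_residue {f g : ℂ → ℂ} (hf : Differentiable ℂ f)
    (hg : Differentiable ℂ g) {R : ℝ} (hR : 0 < R) (Z : Finset ℂ) (hZ : ∀ z ∈ Z, z ∈ ball (0 : ℂ) R)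
    (hg0 : ∀ z ∈ closedBall (0 : ℂ) R, g z = 0 ↔ z ∈ Z) (hd : ∀ z ∈ Z, deriv g z ≠ 0) :
    (∮ z in C(0, R), f z / g z) = 2 * π * Complex.I * ∑ z ∈ Z, f z / deriv g z := by
  have hds : ∀ c, Differentiable ℂ (dslope g c) := fun c => by
    rw [← differentiableOn_univ, Complex.differentiableOn_dslope univ_mem]
    exact hg.differentiableOn
  -- `dslope g c` equals g'(c) at c and vanishes at the other zeros, so H vanishes on all of Z. Then
  -- H/g has removable singularities, while the subtracted terms divided by g are multiples of 1/(z
  -- − c) on the circle.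
  set H : ℂ → ℂ := fun z => f z - ∑ c ∈ Z, f c / deriv g c * dslope g c z with hH
  have hHd : Differentiable ℂ H := hf.sub (Differentiable.fun_sum fun c _ => (hds c).const_mul _)
  have hgZ : ∀ z ∈ Z, g z = 0 := fun z hz => (hg0 z (ball_subset_closedBall (hZ z hz))).2 hz
  have hdsne : ∀ c ∈ Z, ∀ z, z ≠ c → dslope g c z = g z / (z - c) := fun c hc z hzc => by
    rw [dslope_of_ne _ hzc, slope_def_field, hgZ c hc, sub_zero]
  have hHZ : ∀ z ∈ Z, H z = 0 := fun z hz => by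
    rw [hH]
    simp only []
    rw [Finset.sum_eq_single z]
    · rw [dslope_same, div_mul_cancel₀ _ (hd z hz), sub_self]
    · intro c hc hcz
      rw [hdsne c hc z hcz.symm, hgZ z hz]; simp
    · exact fun h => absurd hz h
  classical
  set h : ℂ → ℂ := fun z => if z ∈ Z then deriv H z / deriv g z else H z / g z with hh
  have hopen : ∀ z ∉ Z, ∀ᶠ w in 𝓝 z, w ∉ Z := fun z hz =>
    (Z.finite_toSet.isClosed.isOpen_compl).mem_nhds (by simpa using hz)
  have hdiff : ∀ z ∈ closedBall (0 : ℂ) R, z ∉ Z → DifferentiableAt ℂ h z := by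
    intro z hz hzZ
    have : DifferentiableAt ℂ (fun z => H z / g z) z :=
      (hHd z).div (hg z) fun h0 => hzZ ((hg0 z hz).1 h0)
    refine this.congr_of_eventuallyEq ?_
    filter_upwards [hopen z hzZ] with w hw
    simp [hh, hw]
  have hcont : ContinuousOn h (closedBall 0 R) := by
    intro z hz
    by_cases hzZ : z ∈ Z
    · refine ContinuousAt.continuousWithinAt ?_
      rw [continuousAt_iff_punctured_nhds]
      have h1 := (hHd z).hasDerivAt.tendsto_slope
      have h2 := (hg z).hasDerivAt.tendsto_slope
      have h3 := h1.div h2 (hd z hzZ)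
      have hz' : h z = deriv H z / deriv g z := by simp [hh, hzZ]
      rw [hz']
      refine h3.congr' ?_
      have hoff : ∀ᶠ w in 𝓝[≠] z, w ∉ Z := by
        have : ∀ᶠ w in 𝓝 z, w ∉ Z.erase z :=
          ((Z.erase z).finite_toSet.isClosed.isOpen_compl).mem_nhds (by simp)
        filter_upwards [this.filter_mono nhdsWithin_le_nhds, self_mem_nhdsWithin] with w hw hwz
        intro hwZ
        exact hw (Finset.mem_erase.2 ⟨hwz, hwZ⟩)
      filter_upwards [hoff, self_mem_nhdsWithin] with w hw hwz
      have hwz' : w - z ≠ 0 := sub_ne_zero.2 hwz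
      simp only [hh, hw, if_false, slope_def_field, hHZ z hzZ, hgZ z hzZ, sub_zero, Pi.div_apply]
      rw [div_div_div_cancel_right₀ hwz']
    · exact (hdiff z hz hzZ).continuousAt.continuousWithinAt
  have hzero : (∮ z in C(0, R), h z) = 0 :=
    Complex.circleIntegral_eq_zero_of_differentiable_on_off_countable hR.le
      Z.countable_toSet hcont fun z hz => hdiff z (ball_subset_closedBall hz.1) (by simpa using hz.2)
  have hsZ : ∀ z ∈ sphere (0 : ℂ) R, z ∉ Z := fun z hz hzZ => by
    have := hZ z hzZ
    simp only [mem_sphere_iff_norm, mem_ball_iff_norm] at *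
    linarith
  have hsg : ∀ z ∈ sphere (0 : ℂ) R, g z ≠ 0 := fun z hz h0 =>
    hsZ z hz ((hg0 z (sphere_subset_closedBall hz)).1 h0)
  have hsph : (∮ z in C(0, R), h z) =
      ∮ z in C(0, R), (f z / g z - ∑ c ∈ Z, f c / deriv g c * (z - c)⁻¹) := by
    refine circleIntegral.integral_congr hR.le fun z hz => ?_
    simp only [hh, hsZ z hz, if_false, hH]
    rw [sub_div, Finset.sum_div]
    congr 1
    refine Finset.sum_congr rfl fun c hc => ?_
    rw [hdsne c hc z (fun h => hsZ z hz (h ▸ hc))]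
    have := hsg z hz
    field_simp
  have hci : ∀ c ∈ Z, CircleIntegrable (fun z => f c / deriv g c * (z - c)⁻¹) 0 R := fun c hc => by
    refine ContinuousOn.circleIntegrable hR.le ?_
    refine continuousOn_const.mul (ContinuousOn.inv₀ (by fun_prop) fun z hz h => ?_)
    exact hsZ z hz (sub_eq_zero.1 h ▸ hc)
  have hfi : CircleIntegrable (fun z => f z / g z) 0 R :=
    ContinuousOn.circleIntegrable hR.le
      (hf.continuous.continuousOn.div hg.continuous.continuousOn hsg)
  rw [hsph, circleIntegral.integral_sub hfi (CircleIntegrable.fun_sum _ hci),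
    circleIntegral.integral_fun_sum hci, sub_eq_zero] at hzero
  rw [hzero, Finset.mul_sum]
  refine Finset.sum_congr rfl fun c hc => ?_
  rw [circleIntegral.integral_const_mul, circleIntegral.integral_sub_inv_of_mem_ball (hZ c hc)]
  ring

lemma sum_Ico_neg_eq_sum_range (f : ℤ → ℝ) (m : ℕ) :
    ∑ k ∈ Finset.Ico (-(m : ℤ)) m, f k = ∑ k ∈ Finset.range m, (f k + f (-(k + 1))) := by
  induction m with
  | zero => simp
  | succ m ih =>
    have : Finset.Ico (-((m + 1 : ℕ) : ℤ)) ((m + 1 : ℕ) : ℤ) =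
        insert (-((m : ℤ) + 1)) (insert (m : ℤ) (Finset.Ico (-(m : ℤ)) m)) := by
      ext k
      simp only [Finset.mem_insert, Finset.mem_Ico]
      push_cast
      omega
    rw [this, Finset.sum_insert (by simp), Finset.sum_insert (by simp), ih,
      Finset.sum_range_succ]
    ring

lemma sum_one_div_odd_sq_le (m : ℕ) :
    ∑ k ∈ Finset.range m, 1 / (2 * (k : ℝ) + 1) ^ 2 ≤ π ^ 2 / 8 := by
  set f : ℕ → ℝ := fun n => 1 / (n : ℝ) ^ 2 with hf
  have hs : HasSum f (π ^ 2 / 6) := hasSum_zeta_two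
  have he : HasSum (fun k => f (2 * k)) (π ^ 2 / 24) := by
    have h1 : (fun k => f (2 * k)) = fun k => 1 / 4 * f k := by
      ext k
      simp only [hf, Nat.cast_mul, Nat.cast_ofNat, mul_pow]
      rw [one_div_mul_one_div]
      norm_num
    rw [h1, show π ^ 2 / 24 = 1 / 4 * (π ^ 2 / 6) by ring]
    exact hs.mul_left (1 / 4)
  have ho : Summable (fun k => f (2 * k + 1)) :=
    hs.summable.comp_injective (i := fun k : ℕ => 2 * k + 1) fun a b h => by simpa using h
  have hsum : π ^ 2 / 24 + ∑' k, f (2 * k + 1) = π ^ 2 / 6 :=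
    (HasSum.even_add_odd he ho.hasSum).unique hs
  have hle := ho.sum_le_tsum (Finset.range m) (fun _ _ => by simp only [hf]; positivity)
  have heq : ∀ k : ℕ, f (2 * k + 1) = 1 / (2 * (k : ℝ) + 1) ^ 2 := fun k => by
    simp [hf]
  simp only [heq] at hle hsum
  linarith

/-- Over all integers the sum is exactly 1; this normalisation makes the leading Bernstein constant
1. -/
lemma sum_one_div_half_odd_sq_le (m : ℕ) :
    ∑ k ∈ Finset.Ico (-(m : ℤ)) m, 1 / ((2 * (k : ℝ) + 1) * π / 2) ^ 2 ≤ 1 := by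
  rw [sum_Ico_neg_eq_sum_range (fun k => 1 / ((2 * (k : ℝ) + 1) * π / 2) ^ 2)]
  have : ∀ k : ℕ, 1 / ((2 * ((k : ℤ) : ℝ) + 1) * π / 2) ^ 2 +
      1 / ((2 * ((-((k : ℤ) + 1) : ℤ) : ℝ) + 1) * π / 2) ^ 2 =
      8 / π ^ 2 * (1 / (2 * (k : ℝ) + 1) ^ 2) := fun k => by
    have h2 : (2 * (k : ℝ) + 1) ≠ 0 := by positivity
    have : (2 * ((-((k : ℤ) + 1) : ℤ) : ℝ) + 1) = -(2 * (k : ℝ) + 1) := by push_cast; ring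
    rw [this, Int.cast_natCast]
    field_simp
    ring
  simp_rw [this]
  rw [← Finset.mul_sum]
  calc _ ≤ 8 / π ^ 2 * (π ^ 2 / 8) := by gcongr; exact sum_one_div_odd_sq_le m
    _ = 1 := by field_simp

/-- The circle avoids the zeros of cos. If |Im z| ≥ 1, sinh|Im z| is already a fixed fraction of the
exponential; otherwise |Re z| is within 1/2 of mπ, where |cos| is near 1. -/
lemma exp_abs_im_le_norm_cos {m : ℕ} (hm : 1 ≤ m) {z : ℂ} (hz : ‖z‖ = m * π) :
    Real.exp |z.im| ≤ 4 * ‖Complex.cos z‖ := by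
  have hsq : ‖Complex.cos z‖ ^ 2 = Real.cos z.re ^ 2 + Real.sinh z.im ^ 2 := by
    conv_lhs => rw [← Complex.re_add_im z, Complex.cos_add_mul_I]
    rw [← Complex.ofReal_cos, ← Complex.ofReal_cosh, ← Complex.ofReal_sin, ← Complex.ofReal_sinh,
      ← Complex.ofReal_mul, ← Complex.ofReal_mul, sub_eq_add_neg, ← neg_mul, ← Complex.ofReal_neg,
      Complex.sq_norm, Complex.normSq_add_mul_I]
    have h1 := Real.cos_sq_add_sin_sq z.re
    have h2 := Real.cosh_sq z.im
    have h3 : Real.sin z.re ^ 2 = 1 - Real.cos z.re ^ 2 := by linarith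
    rw [mul_pow, neg_sq, mul_pow, h2, h3]
    ring
  have hpi := Real.pi_gt_three
  rcases le_total 1 |z.im| with hy | hy
  · have h1 : Real.sinh |z.im| ≤ ‖Complex.cos z‖ := by
      refine abs_le_of_sq_le_sq' ?_ (norm_nonneg _) |>.2
      rw [hsq, ← Real.abs_sinh, sq_abs]
      nlinarith [sq_nonneg (Real.cos z.re)]
    have h2 : Real.exp (-|z.im|) ≤ 1 := Real.exp_le_one_iff.2 (by linarith)
    have h3 : 2 ≤ Real.exp |z.im| := by linarith [Real.add_one_le_exp |z.im|]
    rw [Real.sinh_eq] at h1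
    linarith
  · set y := |z.im| with hydef
    set u := |z.re| with hu
    have hy0 : 0 ≤ y := abs_nonneg _
    have hu0 : 0 ≤ u := abs_nonneg _
    have hm' : (1 : ℝ) ≤ m := by exact_mod_cast hm
    have hR : 3 ≤ m * π := by nlinarith
    have hnorm : u ^ 2 + y ^ 2 = (m * π) ^ 2 := by
      rw [← hz, Complex.sq_norm, Complex.normSq_apply, hu, hydef, sq_abs, sq_abs]; ring
    set s := m * π - u with hs
    have hs0 : 0 ≤ s := by nlinarith
    have hs1 : s ≤ 1 / 2 := by nlinarith
    have hcos : Real.cos z.re ^ 2 = Real.cos s ^ 2 := by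
      rw [← sq_abs (Real.cos s), hs, Real.cos_nat_mul_pi_sub, abs_mul, abs_pow]
      simp [hu]
    have h1 := Real.one_sub_sq_div_two_le_cos (x := s)
    have h2 : 3 / 4 ≤ Real.cos s := by nlinarith
    have h3 : Real.cos s ≤ ‖Complex.cos z‖ := by
      refine abs_le_of_sq_le_sq' ?_ (norm_nonneg _) |>.2
      rw [hsq, hcos]
      nlinarith [sq_nonneg (Real.sinh z.im)]
    have h4 : Real.exp y ≤ Real.exp 1 := Real.exp_le_exp.2 hy
    linarith [Real.exp_one_lt_d9]

/-- Let O be the odd part of G, which keeps the bound M e^{|Im z|} and the derivative at 0, and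
vanishes at 0. Integrate O(z)/(z² cos z) over |z| = mπ. The residue at 0 is G'(0). The zeros p of
cos are real, so their residues have modulus at most M/p², with total at most M. The growth of cos
absorbs that of O on the contour, leaving at most 4M/m. -/
lemma norm_deriv_zero_le_of_le_exp_abs_im {G : ℂ → ℂ} (hG : Differentiable ℂ G) {m : ℕ}
    (hm : 1 ≤ m) {M : ℝ} (hM : ∀ z : ℂ, ‖z‖ ≤ m * π → ‖G z‖ ≤ M * Real.exp |z.im|) :
    ‖deriv G 0‖ ≤ M * (1 + 4 / m) := by
  have hpi := Real.pi_gt_three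
  have hm' : (1 : ℝ) ≤ m := by exact_mod_cast hm
  set R : ℝ := m * π with hR
  have hR0 : 0 < R := by positivity
  have hM0 : 0 ≤ M := by
    have := (norm_nonneg _).trans (hM 0 (by simp [hR0.le]))
    simpa using this
  set O : ℂ → ℂ := fun z => (G z - G (-z)) / 2 with hO
  have hOd : Differentiable ℂ O := (hG.sub (hG.comp differentiable_neg)).div_const 2
  have hO0 : O 0 = 0 := by simp [hO]
  have hOle : ∀ z : ℂ, ‖z‖ ≤ R → ‖O z‖ ≤ M * Real.exp |z.im| := fun z hz => by
    have h1 := hM z hz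
    have h2 := hM (-z) (by simpa using hz)
    simp only [Complex.neg_im, abs_neg] at h2
    have h3 := norm_sub_le (G z) (G (-z))
    simp only [hO, norm_div, Complex.norm_ofNat]
    linarith
  have hO' : deriv O 0 = deriv G 0 := by
    have h1 : HasDerivAt G (deriv G 0) 0 := (hG 0).hasDerivAt
    have h2 : HasDerivAt (fun z => G (-z)) (-deriv G 0) 0 := by
      have h1' : HasDerivAt G (deriv G 0) (-0) := by simpa using h1
      have h3 := HasDerivAt.comp (0 : ℂ) h1' (hasDerivAt_neg (0 : ℂ))
      rw [mul_neg_one] at h3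
      exact h3
    have := ((h1.sub h2).div_const 2).deriv
    rw [show O = fun z => (G z - G (-z)) / 2 from rfl]
    refine this.trans ?_
    ring
  set E : ℂ → ℂ := dslope O 0 with hE
  have hEd : Differentiable ℂ E := by
    rw [← differentiableOn_univ, hE, Complex.differentiableOn_dslope univ_mem]
    exact hOd.differentiableOn
  have hE0 : E 0 = deriv G 0 := by rw [hE, dslope_same, hO']
  have hEne : ∀ z, z ≠ 0 → E z = O z / z := fun z hz => by
    rw [hE, dslope_of_ne _ hz, slope_def_field, hO0]; simp
  set g : ℂ → ℂ := fun z => z * Complex.cos z with hg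
  have hgd : Differentiable ℂ g := differentiable_id.mul Complex.differentiable_cos
  have hgder : ∀ z, deriv g z = Complex.cos z - z * Complex.sin z := fun z => by
    have := ((hasDerivAt_id z).mul (Complex.hasDerivAt_cos z)).deriv
    rw [show g = id * Complex.cos from rfl, this]; simp; ring
  set p : ℤ → ℂ := fun k => (2 * k + 1) * π / 2 with hp
  have hpr : ∀ k, p k = (((2 * (k : ℝ) + 1) * π / 2 : ℝ) : ℂ) := fun k => by
    simp [hp]
  have hpinj : Function.Injective p := by
    intro j k hjk
    rw [hpr, hpr, Complex.ofReal_inj] at hjk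
    have : (j : ℝ) = k := by
      have hpi0 := Real.pi_ne_zero
      field_simp at hjk
      linarith
    exact_mod_cast this
  have hpn : ∀ k, ‖p k‖ = |2 * (k : ℝ) + 1| * π / 2 := fun k => by
    rw [hpr, Complex.norm_real, Real.norm_eq_abs, abs_div, abs_mul, abs_of_pos Real.pi_pos,
      abs_two]
  have hp0 : ∀ k, p k ≠ 0 := fun k h => by
    have h1 := hpn k
    rw [h, norm_zero] at h1
    have h2 : |2 * (k : ℝ) + 1| = 0 := by nlinarith [abs_nonneg (2 * (k : ℝ) + 1)]
    have h3 : 2 * k + 1 = 0 := by exact_mod_cast abs_eq_zero.1 h2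
    omega
  have hpmem : ∀ k : ℤ, ‖p k‖ ≤ R ↔ k ∈ Finset.Ico (-(m : ℤ)) m := fun k => by
    rw [hpn, hR, div_le_iff₀ two_pos, show (m : ℝ) * π * 2 = (2 * m) * π by ring,
      mul_le_mul_iff_left₀ Real.pi_pos, abs_le, Finset.mem_Ico]
    constructor
    · rintro ⟨h1, h2⟩
      have h1' : -(2 * (m : ℤ)) ≤ 2 * k + 1 := by exact_mod_cast h1
      have h2' : 2 * k + 1 ≤ 2 * (m : ℤ) := by exact_mod_cast h2
      omega
    · rintro ⟨h1, h2⟩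
      have h1' : -(2 * (m : ℤ)) ≤ 2 * k + 1 := by omega
      have h2' : 2 * k + 1 ≤ 2 * (m : ℤ) := by omega
      exact ⟨by exact_mod_cast h1', by exact_mod_cast h2'⟩
  -- The odd number 2k+1 cannot have modulus 2m, so no pole lies on the contour.
  have hplt : ∀ k ∈ Finset.Ico (-(m : ℤ)) m, ‖p k‖ < R := fun k hk => by
    refine lt_of_le_of_ne ((hpmem k).2 hk) fun h => ?_
    rw [hpn, hR] at h
    have h2 : |2 * (k : ℝ) + 1| = 2 * m := by
      have := Real.pi_ne_zero
      field_simp at h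
      linarith
    have h3 : |2 * k + 1| = 2 * (m : ℤ) := by exact_mod_cast h2
    rcases abs_cases (2 * k + 1) with h | h <;> omega
  have hcosp : ∀ k, Complex.cos (p k) = 0 := fun k => Complex.cos_eq_zero_iff.2 ⟨k, rfl⟩
  have hsinp : ∀ k, ‖Complex.sin (p k)‖ = 1 := fun k => by
    have h := Complex.sin_sq_add_cos_sq (p k)
    rw [hcosp] at h
    have h2 : ‖Complex.sin (p k)‖ ^ 2 = 1 := by
      rw [← norm_pow]
      have : Complex.sin (p k) ^ 2 = 1 := by simpa using h
      rw [this, norm_one]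
    exact (pow_eq_one_iff_of_nonneg (norm_nonneg _) two_ne_zero).1 h2
  set Z₁ : Finset ℂ := (Finset.Ico (-(m : ℤ)) m).image p with hZ₁
  have h0Z : (0 : ℂ) ∉ Z₁ := by
    rw [hZ₁, Finset.mem_image]
    rintro ⟨k, -, hk⟩
    exact hp0 k hk
  have hres := circleIntegral_div_eq_sum_residue hEd hgd hR0 (insert 0 Z₁) (by
      intro z hz
      rw [mem_ball_zero_iff]
      rcases Finset.mem_insert.1 hz with rfl | hz
      · simpa using hR0
      · obtain ⟨k, hk, rfl⟩ := Finset.mem_image.1 hz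
        exact hplt k hk) (by
      intro z hz
      rw [mem_closedBall_zero_iff] at hz
      simp only [hg, mul_eq_zero, Finset.mem_insert]
      refine or_congr Iff.rfl ?_
      rw [Complex.cos_eq_zero_iff, hZ₁, Finset.mem_image]
      constructor
      · rintro ⟨k, rfl⟩
        exact ⟨k, (hpmem k).1 hz, rfl⟩
      · rintro ⟨k, -, rfl⟩
        exact ⟨k, rfl⟩) (by
      intro z hz
      rw [hgder]
      rcases Finset.mem_insert.1 hz with rfl | hz
      · simp
      · obtain ⟨k, hk, rfl⟩ := Finset.mem_image.1 hz
        rw [hcosp, zero_sub, neg_ne_zero]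
        refine mul_ne_zero (hp0 k) fun h => ?_
        have := hsinp k
        rw [h, norm_zero] at this
        exact zero_ne_one this)
  rw [Finset.sum_insert h0Z, hgder 0, hE0, hZ₁, Finset.sum_image hpinj.injOn] at hres
  simp only [Complex.cos_zero, zero_mul, sub_zero, div_one] at hres
  set S := ∑ k ∈ Finset.Ico (-(m : ℤ)) m, E (p k) / deriv g (p k) with hS
  have hSle : ‖S‖ ≤ M := by
    calc ‖S‖ ≤ ∑ k ∈ Finset.Ico (-(m : ℤ)) m, M * (1 / ((2 * (k : ℝ) + 1) * π / 2) ^ 2) := by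
          refine norm_sum_le_of_le _ fun k hk => ?_
          rw [hEne _ (hp0 k), hgder, hcosp, zero_sub, norm_div, norm_div, norm_neg, norm_mul,
            hsinp, mul_one, div_div, ← sq, hpr, Complex.norm_real, Real.norm_eq_abs, sq_abs,
            ← hpr, div_eq_mul_one_div]
          have h1 := hOle (p k) (hplt k hk).le
          have h2 : (p k).im = 0 := by rw [hpr, Complex.ofReal_im]
          rw [h2, abs_zero, Real.exp_zero, mul_one] at h1
          gcongr
      _ = M * ∑ k ∈ Finset.Ico (-(m : ℤ)) m, 1 / ((2 * (k : ℝ) + 1) * π / 2) ^ 2 := by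
          rw [Finset.mul_sum]
      _ ≤ M * 1 := by gcongr; exact sum_one_div_half_odd_sq_le m
      _ = M := mul_one M
  have hint := circleIntegral.norm_two_pi_i_inv_smul_integral_le_of_norm_le_const
    (f := fun z => E z / g z) (c := 0) (C := M * 4 / R ^ 2) hR0.le (by
      intro z hz
      rw [mem_sphere_zero_iff_norm] at hz
      have hz0 : z ≠ 0 := by rintro rfl; simp at hz; exact hR0.ne hz
      have h1 := hOle z hz.le
      have h2 := exp_abs_im_le_norm_cos hm hz
      have h3 : 0 < ‖Complex.cos z‖ := by linarith [Real.exp_pos |z.im|]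
      rw [hEne z hz0, hg]
      simp only [norm_div, norm_mul]
      rw [div_div, hz, div_le_div_iff₀ (by positivity) (by positivity)]
      have : ‖O z‖ ≤ M * (4 * ‖Complex.cos z‖) := h1.trans (by gcongr)
      nlinarith [mul_le_mul_of_nonneg_right this (sq_nonneg R)])
  rw [hres, smul_eq_mul, inv_mul_cancel_left₀ (by simp [Real.pi_ne_zero])] at hint
  have h1 : ‖deriv G 0‖ ≤ ‖deriv G 0 + S‖ + ‖S‖ := by
    have := norm_sub_le (deriv G 0 + S) S
    simpa using this
  have h2 : R * (M * 4 / R ^ 2) ≤ M * (4 / m) := by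
    rw [show R * (M * 4 / R ^ 2) = M * (4 / R) by field_simp]
    gcongr
    rw [hR]; nlinarith
  linarith

/-- A local Bernstein inequality: a function of exponential type `σ` on a disc whose radius is a
multiple of `π / σ`. -/
lemma norm_deriv_le_of_local_exponential_type {F : ℂ → ℂ} (hF : Differentiable ℂ F) {m : ℕ}
    (hm : 1 ≤ m) {M σ : ℝ} (hσ : 0 < σ)
    (hM : ∀ z : ℂ, ‖z‖ ≤ m * π / σ → ‖F z‖ ≤ M * Real.exp (σ * |z.im|)) :
    ‖deriv F 0‖ ≤ M * σ * (1 + 4 / m) := by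
  have hσ' : (σ : ℂ) ≠ 0 := by exact_mod_cast hσ.ne'
  set G : ℂ → ℂ := fun z => F (z / σ) with hG
  have h1 : HasDerivAt G (deriv F 0 * (1 / σ)) 0 := by
    have h0 : HasDerivAt F (deriv F 0) ((0 : ℂ) / σ) := by simpa using (hF 0).hasDerivAt
    exact h0.comp 0 ((hasDerivAt_id (0 : ℂ)).div_const (σ : ℂ))
  have h2 := norm_deriv_zero_le_of_le_exp_abs_im (G := G) (M := M)
    (hF.comp (differentiable_id.div_const _)) hm (by
      intro z hz
      have hn : ‖z / (σ : ℂ)‖ = ‖z‖ / σ := by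
        rw [norm_div, Complex.norm_real, Real.norm_eq_abs, abs_of_pos hσ]
      have hi : (z / (σ : ℂ)).im = z.im / σ := Complex.div_ofReal_im z σ
      have := hM (z / σ) (by rw [hn]; gcongr)
      rw [hi, abs_div, abs_of_pos hσ, mul_div_cancel₀ _ hσ.ne'] at this
      exact this)
  rw [h1.deriv, norm_mul, norm_div, norm_one, Complex.norm_real, Real.norm_eq_abs,
    abs_of_pos hσ, mul_one_div, div_le_iff₀ hσ] at h2
  linarith

/-! ### The node polynomial against e^{-nα}. -/

section

variable {n : ℕ} {x : Fin n → ℝ}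

lemma nodePoly_eval (x : Fin n → ℝ) (t : ℝ) : (nodePoly x).eval t = ∏ i, (t - x i) :=
  Lagrange.eval_nodal

lemma nodePolyC_eq (x : Fin n → ℝ) (z : ℂ) : nodePolyC x z = ∏ i, (z - x i) := by
  simp [nodePolyC, nodePoly, Lagrange.nodal, map_prod]

lemma nodePolyC_ofReal (x : Fin n → ℝ) (t : ℝ) :
    nodePolyC x t = ((nodePoly x).eval t : ℝ) := by
  rw [nodePolyC_eq, nodePoly_eval]; push_cast; rfl

lemma derivative_nodePoly_ne_zero (hx : Function.Injective x) (k : Fin n) :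
    (nodePoly x).derivative.eval (x k) ≠ 0 := by
  have h := Lagrange.nodalWeight_ne_zero (s := Finset.univ) (v := x) hx.injOn (Finset.mem_univ k)
  rw [Lagrange.nodalWeight_eq_eval_derivative_nodal (Finset.mem_univ k)] at h
  exact fun h0 => h (by rw [nodePoly] at h0; rw [h0, inv_zero])

lemma exp_mul_alpha (hn : 1 ≤ n) (hx : Function.Injective x) :
    Real.exp (n * alpha x) = ∑ k, 1 / |(nodePoly x).derivative.eval (x k)| := by
  have hn' : (n : ℝ) ≠ 0 := by positivity
  have : Nonempty (Fin n) := ⟨⟨0, hn⟩⟩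
  have hpos : 0 < ∑ k, 1 / |(nodePoly x).derivative.eval (x k)| :=
    Finset.sum_pos (fun k _ => one_div_pos.2 (abs_pos.2 (derivative_nodePoly_ne_zero hx k)))
      Finset.univ_nonempty
  rw [alpha, ← mul_assoc, mul_one_div_cancel hn', one_mul, Real.exp_log hpos]

lemma abs_basis_eval {t : ℝ} (ht : ∀ i, t ≠ x i) (k : Fin n) :
    |(Lagrange.basis Finset.univ x k).eval t| =
      |(nodePoly x).eval t| * (1 / |(nodePoly x).derivative.eval (x k)|) / |t - x k| := by
  rw [Lagrange.eval_basis_not_at_node (Finset.mem_univ k) (ht k),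
    Lagrange.nodalWeight_eq_eval_derivative_nodal (Finset.mem_univ k), abs_mul, abs_mul, abs_inv,
    abs_inv, nodePoly]
  ring

/-- Each term |P(t)| / |P'(x_k)| equals |ℓ_k(t)| |t − x_k|, and two points of [−1, 1] are at
distance at most 2. -/
lemma abs_eval_mul_exp_le (hn : 1 ≤ n) (hx : Function.Injective x)
    (hmem : ∀ i, x i ∈ Icc (-1 : ℝ) 1) {t : ℝ} (ht : t ∈ Icc (-1 : ℝ) 1) :
    |(nodePoly x).eval t| * Real.exp (n * alpha x) ≤ 2 * lebesgueFun x t := by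
  by_cases h : ∃ i, t = x i
  · obtain ⟨i, rfl⟩ := h
    have : (nodePoly x).eval (x i) = 0 := Lagrange.eval_nodal_at_node (Finset.mem_univ i)
    rw [this, abs_zero, zero_mul]
    exact mul_nonneg two_pos.le (Finset.sum_nonneg fun _ _ => abs_nonneg _)
  push Not at h
  rw [exp_mul_alpha hn hx, lebesgueFun, Finset.mul_sum, Finset.mul_sum]
  refine Finset.sum_le_sum fun k _ => ?_
  rw [abs_basis_eval h]
  have h1 : 0 < |t - x k| := abs_pos.2 (sub_ne_zero.2 (h k))
  have h2 : |t - x k| ≤ 2 := abs_le.2 ⟨by linarith [ht.1, (hmem k).2], by linarith [ht.2, (hmem k).1]⟩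
  rw [← mul_div_assoc (2 : ℝ), le_div_iff₀ h1, mul_comm (2 : ℝ)]
  gcongr

lemma nodeDist_le_abs_sub (x : Fin n → ℝ) (t : ℝ) (i : Fin n) : nodeDist x t ≤ |t - x i| :=
  ciInf_le ⟨0, by rintro _ ⟨j, rfl⟩; exact abs_nonneg _⟩ i

lemma exists_nodeDist_eq (hn : 1 ≤ n) (x : Fin n → ℝ) (t : ℝ) : ∃ i, nodeDist x t = |t - x i| := by
  have : Nonempty (Fin n) := ⟨⟨0, hn⟩⟩
  obtain ⟨i, hi⟩ := exists_eq_ciInf_of_finite (f := fun i => |t - x i|)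
  exact ⟨i, hi.symm⟩

/-- From 1 = Σ ℓ_k(t), bounding every |t − x_k| below by δ(t). No bound on the Lebesgue function
enters, so this holds for every real t. -/
lemma nodeDist_le_abs_eval (hn : 1 ≤ n) (hx : Function.Injective x) (t : ℝ) :
    nodeDist x t ≤ |(nodePoly x).eval t| * Real.exp (n * alpha x) := by
  have : Nonempty (Fin n) := ⟨⟨0, hn⟩⟩
  by_cases h : ∃ i, t = x i
  · obtain ⟨i, rfl⟩ := h
    refine (nodeDist_le_abs_sub x _ i).trans ?_
    rw [sub_self, abs_zero]
    positivity
  push Not at h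
  have hd : 0 < nodeDist x t := by
    obtain ⟨i, hi⟩ := exists_nodeDist_eq hn x t
    rw [hi]
    exact abs_pos.2 (sub_ne_zero.2 (h i))
  have h1 : ∑ k, (Lagrange.basis Finset.univ x k).eval t = 1 := by
    rw [← Polynomial.eval_finsetSum, Lagrange.sum_basis hx.injOn Finset.univ_nonempty,
      Polynomial.eval_one]
  have h2 : (1 : ℝ) ≤ ∑ k, |(nodePoly x).eval t| *
      (1 / |(nodePoly x).derivative.eval (x k)|) / nodeDist x t := by
    calc (1 : ℝ) = |∑ k, (Lagrange.basis Finset.univ x k).eval t| := by rw [h1, abs_one]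
      _ ≤ ∑ k, |(Lagrange.basis Finset.univ x k).eval t| := Finset.abs_sum_le_sum_abs _ _
      _ ≤ _ := Finset.sum_le_sum fun k _ => by
        rw [abs_basis_eval h]
        gcongr
        exact nodeDist_le_abs_sub x t k
  rw [← Finset.sum_div, ← Finset.mul_sum, ← exp_mul_alpha hn hx, le_div_iff₀ hd, one_mul] at h2
  exact h2

/-- The n balls of this radius about the nodes have total length (q − p)/2 and cannot cover the
interval. -/
lemma exists_le_nodeDist (hn : 1 ≤ n) (x : Fin n → ℝ) {p q : ℝ} (hpq : p < q) :
    ∃ t ∈ Icc p q, (q - p) / (4 * n) ≤ nodeDist x t := by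
  by_contra! hcon
  have hn' : (0 : ℝ) < n := by exact_mod_cast hn
  set r := (q - p) / (4 * n) with hr
  have hr0 : 0 < r := div_pos (by linarith) (by positivity)
  have hsub : Icc p q ⊆ ⋃ i, ball (x i) r := fun t ht => by
    obtain ⟨i, hi⟩ := exists_nodeDist_eq hn x t
    refine mem_iUnion.2 ⟨i, ?_⟩
    rw [Metric.mem_ball, Real.dist_eq, ← hi]
    exact hcon t ht
  have h1 := (measure_mono (μ := volume) hsub).trans (measure_iUnion_fintype_le volume _)
  simp only [Real.volume_Icc, Real.volume_ball, Finset.sum_const, Finset.card_univ,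
    Fintype.card_fin, nsmul_eq_mul] at h1
  rw [← ENNReal.ofReal_natCast, ← ENNReal.ofReal_mul hn'.le,
    ENNReal.ofReal_le_ofReal_iff (by positivity)] at h1
  have : (n : ℝ) * (2 * r) = (q - p) / 2 := by rw [hr]; field_simp; ring
  linarith

/-- `n (α - U(v))`, the logarithm of `|P(v)|` normalised by `e^{-n α}`. -/
noncomputable def normLog (x : Fin n → ℝ) (v : ℝ) : ℝ := n * alpha x + ∑ i, Real.log (v - x i)

lemma logPotential_eq (x : Fin n → ℝ) (z : ℂ) :
    logPotential x z = -(1 / (n : ℝ)) * ∑ i, Real.log ‖z - x i‖ := by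
  simp only [logPotential, one_div, Real.log_inv, Finset.sum_neg_distrib]
  ring

lemma logPotential_sub_alpha (hn : 1 ≤ n) (x : Fin n → ℝ) (v : ℝ) :
    logPotential x v - alpha x = -(1 / (n : ℝ)) * normLog x v := by
  have hn' : (n : ℝ) ≠ 0 := by positivity
  have : ∀ i, Real.log ‖(v : ℂ) - x i‖ = Real.log (v - x i) := fun i => by
    rw [← Complex.ofReal_sub, Complex.norm_real, Real.norm_eq_abs, Real.log_abs]
  simp only [logPotential_eq, normLog, this]
  field_simp
  ring

lemma exp_normLog {v : ℝ} (hv : ∀ i, v ≠ x i) :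
    Real.exp (normLog x v) = |(nodePoly x).eval v| * Real.exp (n * alpha x) := by
  rw [normLog, Real.exp_add, Real.exp_sum, nodePoly_eval, Finset.abs_prod, mul_comm]
  congr 1
  refine Finset.prod_congr rfl fun i _ => ?_
  rw [← Real.log_abs, Real.exp_log (abs_pos.2 (sub_ne_zero.2 (hv i)))]

lemma ae_ne_nodes (x : Fin n → ℝ) : ∀ᵐ v : ℝ, ∀ i, v ≠ x i := by
  rw [ae_all_iff]
  intro i
  rw [ae_iff]; simp

/-- Nonnegative error term near the nodes. -/
noncomputable def nodeCap (x : Fin n → ℝ) (v : ℝ) : ℝ := ∑ i, logCap (1 / (n : ℝ) ^ 2) (v - x i)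

lemma nodeCap_nonneg (x : Fin n → ℝ) (v : ℝ) : 0 ≤ nodeCap x v :=
  Finset.sum_nonneg fun _ _ => logCap_nonneg _ _

lemma integrable_nodeCap (hn : 1 ≤ n) (x : Fin n → ℝ) : Integrable (nodeCap x) :=
  integrable_finsetSum _ fun i _ =>
    (integrable_logCap (by positivity)).comp_sub_right (x i)

/-- The truncation radius 1/n² makes the mass small enough to survive multiplication by the kernel
maximum 1/η when η ≥ log n / n. -/
lemma integral_nodeCap (hn : 1 ≤ n) (x : Fin n → ℝ) : ∫ v, nodeCap x v = 2 / n := by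
  have hn' : (n : ℝ) ≠ 0 := by positivity
  unfold nodeCap
  rw [integral_finsetSum _ fun i _ =>
    (integrable_logCap (by positivity)).comp_sub_right (x i)]
  have : ∀ i, ∫ v, logCap (1 / (n : ℝ) ^ 2) (v - x i) = 2 * (1 / (n : ℝ) ^ 2) := fun i => by
    rw [integral_sub_right_eq_self (logCap (1 / (n : ℝ) ^ 2)),
      integral_logCap (by positivity)]
  simp only [this, Finset.sum_const, Finset.card_univ, Fintype.card_fin, nsmul_eq_mul]
  field_simp

/-- By δ(v) ≤ |P(v)| e^{nα}, only the nearest node matters, and its truncated logarithm is one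
nonnegative summand of `nodeCap`. -/
lemma neg_nodeCap_le_normLog (hn : 1 ≤ n) (hx : Function.Injective x) {v : ℝ}
    (hv : ∀ i, v ≠ x i) : -(2 * Real.log n) - nodeCap x v ≤ normLog x v := by
  obtain ⟨i, hi⟩ := exists_nodeDist_eq hn x v
  have h1 := nodeDist_le_abs_eval hn hx v
  rw [← exp_normLog hv, hi, ← Real.log_le_iff_le_exp (abs_pos.2 (sub_ne_zero.2 (hv i))),
    Real.log_abs] at h1
  have h2 : logCap (1 / (n : ℝ) ^ 2) (v - x i) ≤ nodeCap x v :=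
    Finset.single_le_sum (f := fun i => logCap (1 / (n : ℝ) ^ 2) (v - x i))
      (fun _ _ => logCap_nonneg _ _) (Finset.mem_univ i)
  have h3 : Real.log (1 / (n : ℝ) ^ 2) - Real.log (v - x i) ≤ _ := le_max_left _ 0
  rw [one_div, Real.log_inv, Real.log_pow, Nat.cast_ofNat] at h3
  have h4 : -(2 * Real.log n) - Real.log (v - x i) ≤ logCap (1 / (n : ℝ) ^ 2) (v - x i) := by
    unfold logCap
    rw [one_div, Real.log_inv, Real.log_pow, Nat.cast_ofNat]
    exact h3
  linarith

lemma integrable_cauchyWeight_mul_normLog (x : Fin n → ℝ) :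
    Integrable (fun v => cauchyWeight v * normLog x v) := by
  have : (fun v => cauchyWeight v * normLog x v) = fun v => cauchyWeight v * (n * alpha x) +
      ∑ i, cauchyWeight v * Real.log (v - x i) := by
    ext v; rw [normLog, mul_add, Finset.mul_sum]
  rw [this]
  exact (integrable_cauchyWeight.mul_const _).add
    (integrable_finsetSum _ fun i _ => integrable_cauchyWeight_mul_log (x i))

lemma integral_cauchyWeight_mul_sum_abs_log_le (hmem : ∀ i, x i ∈ Icc (-1 : ℝ) 1) :
    Integrable (fun v => cauchyWeight v * ∑ i, |Real.log (v - x i)|) ∧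
      ∫ v, cauchyWeight v * ∑ i, |Real.log (v - x i)| ≤ 3 * π * n := by
  have hi : ∀ i, Integrable (fun v => cauchyWeight v * |Real.log (v - x i)|) := fun i => by
    have := (integrable_cauchyWeight_mul_log (x i)).abs
    refine this.congr (ae_of_all _ fun v => ?_)
    simp only [abs_mul, abs_of_pos (cauchyWeight_pos v)]
  simp_rw [Finset.mul_sum]
  refine ⟨integrable_finsetSum _ fun i _ => hi i, ?_⟩
  rw [integral_finsetSum _ fun i _ => hi i]
  calc _ ≤ ∑ _i : Fin n, 3 * π := Finset.sum_le_sum fun i _ =>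
        integral_cauchyWeight_mul_abs_log_le (abs_le.2 (hmem i))
    _ = 3 * π * n := by simp; ring

/-- This crude O(n) size is the global control used outside I for the upper bounds on ρ and the
Poisson remainder. -/
lemma integral_cauchyWeight_mul_abs_normLog_le (hmem : ∀ i, x i ∈ Icc (-1 : ℝ) 1) :
    ∫ v, cauchyWeight v * |normLog x v| ≤ (|alpha x| + 3) * π * n := by
  obtain ⟨h1, h2⟩ := integral_cauchyWeight_mul_sum_abs_log_le hmem
  have h3 : ∫ v, cauchyWeight v * |normLog x v| ≤
      ∫ v, (cauchyWeight v * (n * |alpha x|) + cauchyWeight v * ∑ i, |Real.log (v - x i)|) := by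
    refine integral_mono ?_ ((integrable_cauchyWeight.mul_const _).add h1) fun v => ?_
    · refine (integrable_cauchyWeight_mul_normLog x).abs.congr (ae_of_all _ fun v => ?_)
      simp only [abs_mul, abs_of_pos (cauchyWeight_pos v)]
    · simp only []
      rw [← mul_add]
      refine mul_le_mul_of_nonneg_left ?_ (cauchyWeight_pos v).le
      rw [normLog]
      refine (abs_add_le _ _).trans (add_le_add ?_ (Finset.abs_sum_le_sum_abs _ _))
      rw [abs_mul, Nat.abs_cast]
  refine h3.trans ?_
  rw [integral_add (integrable_cauchyWeight.mul_const _) h1, integral_mul_const,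
    integral_cauchyWeight]
  linarith

end

/-! ### Size of P on I and boundedness of α. -/

section

variable {n : ℕ} {x : Fin n → ℝ}

lemma exists_abs_eval_mul_exp_le {a b : ℝ} (K B : ℝ) (ha : -1 ≤ a) (hb : b ≤ 1) :
    ∃ C : ℝ, 1 ≤ C ∧ ∀ n : ℕ, 2 ≤ n → ∀ x : Fin n → ℝ, GoodNodes a b K B x →
      ∀ t ∈ Icc a b, |(nodePoly x).eval t| * Real.exp (n * alpha x) ≤ (n : ℝ) ^ C := by
  have hl2 : 0 < Real.log 2 := Real.log_pos one_lt_two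
  refine ⟨|Real.log (2 * K)| / Real.log 2 + |B| + 1, by
    have : 0 ≤ |Real.log (2 * K)| / Real.log 2 := by positivity
    linarith [abs_nonneg B], fun n hn x hx t ht => ?_⟩
  have hn0 : (0 : ℝ) < n := by positivity
  have hn1 : (1 : ℝ) ≤ n := by exact_mod_cast (by omega : 1 ≤ n)
  have h1 := abs_eval_mul_exp_le (by omega) hx.injective hx.mem_Icc (t := t)
    ⟨by linarith [ht.1], by linarith [ht.2]⟩
  have h2 := hx.lebesgue_le t ht
  -- Since Σ ℓ_k = 1 forces λ ≥ 1, a nonpositive K is impossible; positivity lets 2K be absorbed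
  -- into a power of n ≥ 2.
  have hK : 0 < K := by
    have hne : Nonempty (Fin n) := ⟨⟨0, by omega⟩⟩
    have h3 : (1 : ℝ) ≤ lebesgueFun x t := by
      calc (1 : ℝ) = |∑ k, (Lagrange.basis Finset.univ x k).eval t| := by
            rw [← Polynomial.eval_finsetSum, Lagrange.sum_basis hx.injective.injOn
              Finset.univ_nonempty, Polynomial.eval_one, abs_one]
        _ ≤ _ := Finset.abs_sum_le_sum_abs _ _
    by_contra! hK
    have : K * (n : ℝ) ^ B ≤ 0 := mul_nonpos_of_nonpos_of_nonneg hK (by positivity)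
    linarith
  have hlog : Real.log 2 ≤ Real.log n := Real.log_le_log two_pos (by exact_mod_cast hn)
  calc _ ≤ 2 * (K * (n : ℝ) ^ B) := by linarith
    _ = Real.exp (Real.log (2 * K)) * (n : ℝ) ^ B := by rw [Real.exp_log (by positivity)]; ring
    _ ≤ (n : ℝ) ^ (|Real.log (2 * K)| / Real.log 2) * (n : ℝ) ^ |B| := by
      gcongr
      · rw [Real.rpow_def_of_pos hn0]
        refine Real.exp_le_exp.2 ((le_abs_self _).trans ?_)
        rw [← mul_div_assoc, le_div_iff₀ hl2, mul_comm]
        gcongr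
      · exact le_abs_self B
    _ = (n : ℝ) ^ (|Real.log (2 * K)| / Real.log 2 + |B|) := (Real.rpow_add hn0 _ _).symm
    _ ≤ _ := Real.rpow_le_rpow_of_exponent_le hn1 (by linarith)

lemma normLog_le {C : ℝ} (hn : 1 ≤ n) {v : ℝ} (hv : ∀ i, v ≠ x i)
    (h : |(nodePoly x).eval v| * Real.exp (n * alpha x) ≤ (n : ℝ) ^ C) :
    normLog x v ≤ C * Real.log n := by
  have hn0 : (0 : ℝ) < n := by positivity
  rw [← exp_normLog hv, Real.rpow_def_of_pos hn0, Real.exp_le_exp] at h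
  linarith

lemma abs_eval_le_two_pow (hmem : ∀ i, x i ∈ Icc (-1 : ℝ) 1) {t : ℝ} (ht : t ∈ Icc (-1 : ℝ) 1) :
    |(nodePoly x).eval t| ≤ 2 ^ n := by
  rw [nodePoly_eval, Finset.abs_prod]
  calc ∏ i, |t - x i| ≤ ∏ _i : Fin n, (2 : ℝ) := Finset.prod_le_prod (fun _ _ => abs_nonneg _)
        fun i _ => abs_le.2 ⟨by linarith [ht.1, (hmem i).2], by linarith [ht.2, (hmem i).1]⟩
    _ = 2 ^ n := by simp

/-- Upper bound: integrate nα ≤ C log n + Σ|log|v − x_i|| over I, where the last term has weighted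
mass O(n). Lower bound: evaluate δ ≤ |P| e^{nα} ≤ 2^n e^{nα} at a point far from all nodes. -/
lemma exists_abs_alpha_le {a b : ℝ} (K B : ℝ) (ha : -1 ≤ a) (hab : a < b) (hb : b ≤ 1) :
    ∃ C : ℝ, 0 < C ∧ ∀ n : ℕ, 2 ≤ n → ∀ x : Fin n → ℝ, GoodNodes a b K B x → |alpha x| ≤ C := by
  obtain ⟨C, hC1, hC⟩ := exists_abs_eval_mul_exp_le K B ha hb
  set L := b - a with hL
  have hL0 : 0 < L := by linarith
  have hpi := Real.pi_pos
  refine ⟨2 * π * (C + 3) / L + (|Real.log (L / 4)| + 2), by positivity, fun n hn x hx => ?_⟩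
  have hn0 : (0 : ℝ) < n := by positivity
  have hn1 : (1 : ℝ) ≤ n := by exact_mod_cast (by omega : 1 ≤ n)
  have hlogn : Real.log n ≤ n := by linarith [Real.log_le_sub_one_of_pos hn0]
  have hlogn0 : 0 ≤ Real.log n := Real.log_nonneg hn1
  have hup : alpha x ≤ 2 * π * (C + 3) / L := by
    by_cases hα : alpha x ≤ 0
    · exact hα.trans (by positivity)
    push Not at hα
    obtain ⟨h1, h2⟩ := integral_cauchyWeight_mul_sum_abs_log_le hx.mem_Icc
    have hle : ∀ᵐ v ∂(volume.restrict (Icc a b)), (1 / 2 : ℝ) * (n * alpha x) ≤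
        cauchyWeight v * (C * Real.log n) + cauchyWeight v * ∑ i, |Real.log (v - x i)| := by
      filter_upwards [ae_restrict_of_ae (ae_ne_nodes x), ae_restrict_mem measurableSet_Icc]
        with v hv hI
      have h3 := normLog_le (by omega) hv (hC n hn x hx v hI)
      have h4 : -∑ i, |Real.log (v - x i)| ≤ ∑ i, Real.log (v - x i) :=
        (neg_le_neg (Finset.abs_sum_le_sum_abs _ _)).trans (neg_abs_le _)
      have h5 : n * alpha x ≤ C * Real.log n + ∑ i, |Real.log (v - x i)| := by
        rw [normLog] at h3; linarith
      have h6 : 1 / 2 ≤ cauchyWeight v := by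
        unfold cauchyWeight
        have h7 : -1 ≤ v := by linarith [hI.1]
        have h8 : v ≤ 1 := by linarith [hI.2]
        exact one_div_le_one_div_of_le (by positivity) (by nlinarith)
      rw [← mul_add]
      calc (1 / 2 : ℝ) * (n * alpha x) ≤ cauchyWeight v * (n * alpha x) := by gcongr
        _ ≤ _ := mul_le_mul_of_nonneg_left h5 (cauchyWeight_pos v).le
    have hint := (integrable_cauchyWeight.mul_const (C * Real.log n)).add h1
    have h3 : ∫ v in Icc a b, (1 / 2 : ℝ) * (n * alpha x) ≤
        ∫ v in Icc a b, (cauchyWeight v * (C * Real.log n) +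
          cauchyWeight v * ∑ i, |Real.log (v - x i)|) :=
      integral_mono_ae (integrableOn_const (by simp)) hint.integrableOn hle
    have h4 := h3.trans (setIntegral_le_integral hint (ae_of_all _ fun v => by
      have := (cauchyWeight_pos v).le
      simp only [Pi.zero_apply]
      have : 0 ≤ ∑ i, |Real.log (v - x i)| := Finset.sum_nonneg fun _ _ => abs_nonneg _
      positivity))
    rw [integral_add (integrable_cauchyWeight.mul_const _) h1, integral_mul_const,
      integral_mul_const, integral_cauchyWeight, setIntegral_const,
      Real.volume_real_Icc_of_le hab.le, smul_eq_mul, ← hL] at h4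
    rw [le_div_iff₀ hL0]
    have h5 : π * (C * Real.log n) ≤ π * (C * n) := by gcongr
    have h6 : n * (alpha x * L) ≤ n * (2 * π * (C + 3)) := by nlinarith
    exact le_of_mul_le_mul_left h6 hn0
  have hlow : -(|Real.log (L / 4)| + 2 + 1) ≤ alpha x := by
    obtain ⟨t, ht, hδ⟩ := exists_le_nodeDist (by omega : 1 ≤ n) x hab
    have h1 := hδ.trans (nodeDist_le_abs_eval (by omega) hx.injective t)
    have h2 := abs_eval_le_two_pow hx.mem_Icc (t := t) ⟨by linarith [ht.1], by linarith [ht.2]⟩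
    have h3 : (b - a) / (4 * n) ≤ 2 ^ n * Real.exp (n * alpha x) := h1.trans (by gcongr)
    have h4 := Real.log_le_log (by rw [← hL]; positivity) h3
    rw [Real.log_mul (by positivity) (Real.exp_pos _).ne', Real.log_exp, Real.log_pow, ← hL,
      ← div_div, Real.log_div (by positivity) hn0.ne'] at h4
    have h5 := neg_abs_le (Real.log (L / 4))
    have h6 : |Real.log (L / 4)| ≤ n * |Real.log (L / 4)| :=
      le_mul_of_one_le_left (abs_nonneg _) hn1
    have h7 : n * Real.log 2 ≤ n * 1 := by gcongr; linarith [Real.log_two_lt_d9]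
    have h8 : n * (-(|Real.log (L / 4)| + 2 + 1)) ≤ n * alpha x := by linarith
    exact le_of_mul_le_mul_left h8 hn0
  have h9 : 1 ≤ 2 * π * (C + 3) / L := by
    rw [le_div_iff₀ hL0]
    nlinarith [Real.pi_gt_three]
  refine abs_le.2 ⟨by linarith, ?_⟩
  linarith [abs_nonneg (Real.log (L / 4))]

/-! ### The amplitude on the whole interval. -/

section Amplitude

variable {a b : ℝ}

/-- The function whose supremum over `s` is the amplitude at `t`. -/
noncomputable def dampedAbs (x : Fin n → ℝ) (t s : ℝ) : ℝ :=
  |(nodePoly x).eval s| * Real.exp (-((n : ℝ) ^ (0.1 : ℝ) * |t - s|))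

lemma continuous_dampedAbs (x : Fin n → ℝ) (t : ℝ) : Continuous (dampedAbs x t) := by
  unfold dampedAbs
  exact (Polynomial.continuous _).abs.mul (by fun_prop)

lemma bddAbove_dampedAbs (x : Fin n → ℝ) (t : ℝ) :
    BddAbove (range fun s : Icc a b => dampedAbs x t s) := by
  have := (isCompact_Icc (a := a) (b := b)).bddAbove_image (continuous_dampedAbs x t).continuousOn
  rwa [image_eq_range] at this

lemma dampedAbs_le_amplitude (x : Fin n → ℝ) (t : ℝ) {s : ℝ} (hs : s ∈ Icc a b) :
    dampedAbs x t s ≤ amplitude a b x t :=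
  le_ciSup (bddAbove_dampedAbs x t) (⟨s, hs⟩ : Icc a b)

lemma exists_amplitude_eq (hab : a ≤ b) (x : Fin n → ℝ) (t : ℝ) :
    ∃ s ∈ Icc a b, amplitude a b x t = dampedAbs x t s := by
  obtain ⟨s, hs, hmax⟩ := (isCompact_Icc (a := a) (b := b)).exists_isMaxOn
    ⟨a, left_mem_Icc.2 hab⟩ (continuous_dampedAbs x t).continuousOn
  have : Nonempty (Icc a b) := ⟨⟨a, left_mem_Icc.2 hab⟩⟩
  exact ⟨s, hs, le_antisymm (ciSup_le fun s' => hmax s'.2) (dampedAbs_le_amplitude x t hs)⟩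

lemma abs_eval_le_amplitude (x : Fin n → ℝ) {t : ℝ} (ht : t ∈ Icc a b) :
    |(nodePoly x).eval t| ≤ amplitude a b x t := by
  simpa [dampedAbs] using dampedAbs_le_amplitude x t ht

lemma amplitude_le_exp_mul_amplitude (hab : a ≤ b) (x : Fin n → ℝ) (s t : ℝ) :
    amplitude a b x s ≤ Real.exp ((n : ℝ) ^ (0.1 : ℝ) * |s - t|) * amplitude a b x t := by
  obtain ⟨r, hr, h⟩ := exists_amplitude_eq hab x s
  rw [h]
  refine le_trans ?_ (mul_le_mul_of_nonneg_left (dampedAbs_le_amplitude x t hr) (Real.exp_pos _).le)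
  rw [dampedAbs, dampedAbs, mul_left_comm, ← Real.exp_add]
  gcongr
  have h1 : |t - r| ≤ |s - t| + |s - r| := by
    rw [abs_sub_comm s t]; exact abs_sub_le t s r
  have h2 : (0 : ℝ) ≤ (n : ℝ) ^ (0.1 : ℝ) := by positivity
  nlinarith

lemma exp_neg_mul_amplitude_le_amplitude (hab : a ≤ b) (x : Fin n → ℝ) (s t : ℝ) :
    Real.exp (-((n : ℝ) ^ (0.1 : ℝ) * |s - t|)) * amplitude a b x t ≤ amplitude a b x s := by
  rw [Real.exp_neg, inv_mul_le_iff₀ (Real.exp_pos _), abs_sub_comm]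
  exact amplitude_le_exp_mul_amplitude hab x t s

/-- At a maximiser s, the damped |P(s)| is at most the damped A(s), which is at most A(t) by the
log-Lipschitz bound; equality holds throughout. -/
lemma amplitude_eq_of_eq_dampedAbs (hab : a ≤ b) {x : Fin n → ℝ} {s t : ℝ} (hs : s ∈ Icc a b)
    (h : amplitude a b x t = dampedAbs x t s) :
    amplitude a b x t =
      amplitude a b x s * Real.exp (-((n : ℝ) ^ (0.1 : ℝ) * |t - s|)) := by
  refine le_antisymm ?_ ?_
  · rw [h, dampedAbs]
    gcongr
    exact abs_eval_le_amplitude x hs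
  · rw [mul_comm]; exact exp_neg_mul_amplitude_le_amplitude hab x t s

lemma exists_amplitude_bounds (K B : ℝ) (ha : -1 ≤ a) (hab : a < b) (hb : b ≤ 1) :
    ∃ C : ℝ, 1 ≤ C ∧ ∃ N : ℕ, ∀ n : ℕ, N ≤ n → ∀ x : Fin n → ℝ, GoodNodes a b K B x →
      ∀ t ∈ Icc a b, (n : ℝ) ^ (-C) ≤ amplitude a b x t * Real.exp (n * alpha x) ∧
        amplitude a b x t * Real.exp (n * alpha x) ≤ (n : ℝ) ^ C := by
  obtain ⟨C, hC1, hC⟩ := exists_abs_eval_mul_exp_le K B ha hb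
  -- Makes (b−a)e^{-2}/(4n²) at least n^{-3}, the source of the exponent 3.
  obtain ⟨N, hN⟩ := exists_nat_ge (4 * Real.exp 2 / (b - a))
  refine ⟨C + 3, by linarith, N + 2, fun n hn x hx t ht => ?_⟩
  have hn2 : 2 ≤ n := by omega
  have hn0 : (0 : ℝ) < n := by positivity
  have hn1 : (1 : ℝ) ≤ n := by exact_mod_cast (by omega : 1 ≤ n)
  have hnN : 4 * Real.exp 2 / (b - a) ≤ n := hN.trans (by exact_mod_cast (by omega : N ≤ n))
  have hL0 : 0 < b - a := by linarith
  constructor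
  -- This shrinkage keeps the window [p, p + (b−a)/n] inside [a, b] and within 2/n of t, even when t
  -- is an endpoint; the damping over that distance is at least e^{-2}.
  · set p := a + (t - a) * (1 - 1 / n) with hp
    have hinv : 0 < 1 / (n : ℝ) := by positivity
    have hinv1 : 1 / (n : ℝ) ≤ 1 := by rw [div_le_one hn0]; exact hn1
    set e := 1 / (n : ℝ) with he
    obtain ⟨s, hs, hδ⟩ := exists_le_nodeDist (by omega : 1 ≤ n) x
      (show p < p + (b - a) * e by nlinarith)
    have hpa : a ≤ p := by nlinarith [ht.1]
    have hpb : p + (b - a) * e ≤ b := by nlinarith [ht.2]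
    have hsI : s ∈ Icc a b := ⟨hpa.trans hs.1, hs.2.trans hpb⟩
    have hts : |t - s| ≤ 2 * e := by
      have h1 : t - p = (t - a) * e := by rw [hp]; ring
      have h2 : 0 ≤ (t - a) * e := mul_nonneg (by linarith [ht.1]) hinv.le
      have h3 : (t - a) * e ≤ (b - a) * e := by
        apply mul_le_mul_of_nonneg_right _ hinv.le; linarith [ht.2]
      have h4 : (b - a) * e ≤ 2 * e := by
        apply mul_le_mul_of_nonneg_right _ hinv.le; linarith
      exact abs_le.2 ⟨by linarith [hs.2], by linarith [hs.1]⟩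
    have hexp : (n : ℝ) ^ (0.1 : ℝ) * |t - s| ≤ 2 := by
      have h1 : (n : ℝ) ^ (0.1 : ℝ) ≤ n := by
        conv_rhs => rw [← Real.rpow_one (n : ℝ)]
        exact Real.rpow_le_rpow_of_exponent_le hn1 (by norm_num)
      calc _ ≤ n * (2 * e) := by gcongr
        _ = 2 := by rw [he]; field_simp
    have hA := dampedAbs_le_amplitude x t hsI
    have hd := nodeDist_le_abs_eval (by omega) hx.injective s
    have h1 : (n : ℝ) ^ (-(C + 3)) ≤ (n : ℝ) ^ (-3 : ℝ) :=
      Real.rpow_le_rpow_of_exponent_le hn1 (by linarith)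
    have h2 : (n : ℝ) ^ (-3 : ℝ) ≤ nodeDist x s * Real.exp (-2) := by
      calc (n : ℝ) ^ (-3 : ℝ) = 1 / n ^ 3 := by
            rw [Real.rpow_neg hn0.le, one_div]; norm_cast
        _ ≤ ((b - a) * e) / (4 * n) * Real.exp (-2) := by
            rw [div_le_iff₀ hL0] at hnN
            rw [Real.exp_neg, he]
            have := Real.exp_pos 2
            rw [← div_eq_mul_inv, div_div, mul_one_div, div_div,
              div_le_div_iff₀ (by positivity) (by positivity)]
            have := mul_le_mul_of_nonneg_left hnN (sq_nonneg (n : ℝ))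
            nlinarith
        _ ≤ _ := by
            gcongr
            simpa using hδ
    refine h1.trans (h2.trans ?_)
    calc nodeDist x s * Real.exp (-2) ≤
          |(nodePoly x).eval s| * Real.exp (n * alpha x) * Real.exp (-((n : ℝ) ^ (0.1 : ℝ) * |t - s|)) := by
            gcongr
      _ = dampedAbs x t s * Real.exp (n * alpha x) := by rw [dampedAbs]; ring
      _ ≤ _ := by gcongr
  · obtain ⟨s, hs, h⟩ := exists_amplitude_eq hab.le x t
    have h1 : dampedAbs x t s ≤ |(nodePoly x).eval s| := by
      rw [dampedAbs]
      refine mul_le_of_le_one_right (abs_nonneg _) (Real.exp_le_one_iff.2 ?_)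
      rw [Left.neg_nonpos_iff]; positivity
    calc _ ≤ |(nodePoly x).eval s| * Real.exp (n * alpha x) := by rw [h]; gcongr
      _ ≤ (n : ℝ) ^ C := hC n hn2 x hx s hs
      _ ≤ _ := Real.rpow_le_rpow_of_exponent_le hn1 (by linarith)

end Amplitude

/-- The estimates on the whole interval. -/
theorem amplitude_estimates (a b K B : ℝ) (ha : -1 ≤ a) (hab : a < b) (hb : b ≤ 1) :
    ∃ C : ℝ, 0 < C ∧ ∃ N : ℕ, ∀ n : ℕ, N ≤ n → ∀ x : Fin n → ℝ, GoodNodes a b K B x →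
      |alpha x| ≤ C ∧
      (∀ t ∈ Set.Icc a b,
        nodeDist x t * Real.exp (-(n * alpha x)) ≤ |(nodePoly x).eval t| ∧
          |(nodePoly x).eval t| ≤ C * (n : ℝ) ^ C * Real.exp (-(n * alpha x))) ∧
      (∀ t ∈ Set.Icc a b, |(nodePoly x).eval t| ≤ amplitude a b x t) ∧
      (∀ s ∈ Set.Icc a b, ∀ t ∈ Set.Icc a b,
        Real.exp (-((n : ℝ) ^ (0.1 : ℝ) * |s - t|)) * amplitude a b x t ≤ amplitude a b x s ∧
          amplitude a b x s ≤ Real.exp ((n : ℝ) ^ (0.1 : ℝ) * |s - t|) * amplitude a b x t) ∧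
      (∀ t ∈ Set.Icc a b,
        (n : ℝ) ^ (-C) * Real.exp (-(n * alpha x)) ≤ amplitude a b x t ∧
          amplitude a b x t ≤ (n : ℝ) ^ C * Real.exp (-(n * alpha x))) ∧
      (∀ t ∈ Set.Icc a b, ∃ s ∈ Set.Icc a b,
        |t - s| ≤ C * (Real.log n / (n : ℝ) ^ (0.1 : ℝ)) ∧
        amplitude a b x t =
          |(nodePoly x).eval s| * Real.exp (-((n : ℝ) ^ (0.1 : ℝ) * |t - s|)) ∧
        amplitude a b x t =
          amplitude a b x s * Real.exp (-((n : ℝ) ^ (0.1 : ℝ) * |t - s|))) := by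
  obtain ⟨C₁, hC₁, h₁⟩ := exists_abs_eval_mul_exp_le K B ha hb
  obtain ⟨C₂, hC₂, h₂⟩ := exists_abs_alpha_le K B ha hab hb
  obtain ⟨C₃, hC₃, N, h₃⟩ := exists_amplitude_bounds K B ha hab hb
  refine ⟨C₁ + C₂ + C₃, by linarith, N + 2, fun n hn x hx => ?_⟩
  set C := C₁ + C₂ + C₃ with hC
  have hn2 : 2 ≤ n := by omega
  have hn0 : (0 : ℝ) < n := by positivity
  have hn1 : (1 : ℝ) ≤ n := by exact_mod_cast (by omega : 1 ≤ n)
  have hE : 0 < Real.exp (n * alpha x) := Real.exp_pos _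
  have hle : ∀ c, c ≤ C → (n : ℝ) ^ c ≤ (n : ℝ) ^ C := fun c hc =>
    Real.rpow_le_rpow_of_exponent_le hn1 hc
  refine ⟨(h₂ n hn2 x hx).trans (by linarith), fun t ht => ⟨?_, ?_⟩,
    fun t ht => abs_eval_le_amplitude x ht, fun s _ t _ =>
      ⟨exp_neg_mul_amplitude_le_amplitude hab.le x s t, amplitude_le_exp_mul_amplitude hab.le x s t⟩,
    fun t ht => ?_, fun t ht => ?_⟩
  · rw [Real.exp_neg, ← div_eq_mul_inv, div_le_iff₀ hE]
    exact nodeDist_le_abs_eval (by omega) hx.injective t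
  · rw [Real.exp_neg, ← div_eq_mul_inv, le_div_iff₀ hE]
    refine (h₁ n hn2 x hx t ht).trans ((hle C₁ (by linarith)).trans ?_)
    exact le_mul_of_one_le_left (by positivity) (by linarith)
  · rw [Real.exp_neg, ← div_eq_mul_inv, ← div_eq_mul_inv, div_le_iff₀ hE, le_div_iff₀ hE]
    obtain ⟨h4, h5⟩ := h₃ n (by omega) x hx t ht
    exact ⟨(Real.rpow_le_rpow_of_exponent_le hn1 (by linarith)).trans h4,
      h5.trans (hle C₃ (by linarith))⟩
  · obtain ⟨s, hs, h⟩ := exists_amplitude_eq hab.le x t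
    refine ⟨s, hs, ?_, h, amplitude_eq_of_eq_dampedAbs hab.le hs h⟩
    set y := (n : ℝ) ^ (0.1 : ℝ) with hy
    have hy0 : 0 < y := by positivity
    have h4 := (h₃ n (by omega) x hx t ht).1
    have h5 := h₁ n hn2 x hx s hs
    -- A(t) is polynomially close to e^{-nα} from below and |P(s)| from above, so the damping can be
    -- at most polynomial; taking logarithms bounds |t − s|.
    have h6 : (n : ℝ) ^ (-C₃) ≤ (n : ℝ) ^ C₁ * Real.exp (-(y * |t - s|)) := by
      calc _ ≤ _ := h4
        _ = |(nodePoly x).eval s| * Real.exp (n * alpha x) * Real.exp (-(y * |t - s|)) := by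
          rw [h, dampedAbs]; ring
        _ ≤ _ := by gcongr
    rw [Real.rpow_def_of_pos hn0, Real.rpow_def_of_pos hn0, ← Real.exp_add, Real.exp_le_exp] at h6
    have hl : 0 ≤ Real.log n := Real.log_nonneg hn1
    rw [← mul_div_assoc, le_div_iff₀ hy0, hC]
    nlinarith

end

/-! ### The density ρ and the Poisson decomposition. -/

section

variable {n : ℕ} {x : Fin n → ℝ} {a b t d : ℝ}

lemma measurable_normLog (x : Fin n → ℝ) : Measurable (normLog x) := by
  unfold normLog
  fun_prop

lemma integrable_cauchyWeight_mul_abs_normLog (x : Fin n → ℝ) :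
    Integrable (fun v => cauchyWeight v * |normLog x v|) := by
  refine (integrable_cauchyWeight_mul_normLog x).abs.congr (ae_of_all _ fun v => ?_)
  simp only [abs_mul, abs_of_pos (cauchyWeight_pos v)]

lemma integrableOn_mul_normLog_of_abs_le (x : Fin n → ℝ) {φ : ℝ → ℝ} (hφ : Measurable φ)
    {s : Set ℝ} (hs : MeasurableSet s) {κ : ℝ} (h : ∀ v ∈ s, |φ v| ≤ κ * cauchyWeight v) :
    IntegrableOn (fun v => φ v * normLog x v) s := by
  refine Integrable.mono' ((integrable_cauchyWeight_mul_abs_normLog x).const_mul κ).integrableOn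
    (hφ.mul (measurable_normLog x)).aestronglyMeasurable ?_
  filter_upwards [ae_restrict_mem hs] with v hv
  rw [Real.norm_eq_abs, abs_mul, ← mul_assoc]
  exact mul_le_mul_of_nonneg_right (h v hv) (abs_nonneg _)

lemma abs_setIntegral_mul_normLog_le (x : Fin n → ℝ) {φ : ℝ → ℝ} {s : Set ℝ}
    (hs : MeasurableSet s) {κ : ℝ} (hκ : 0 ≤ κ) (h : ∀ v ∈ s, |φ v| ≤ κ * cauchyWeight v) :
    |∫ v in s, φ v * normLog x v| ≤ κ * ∫ v, cauchyWeight v * |normLog x v| := by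
  have hint := (integrable_cauchyWeight_mul_abs_normLog x).const_mul κ
  rw [← integral_const_mul, ← Real.norm_eq_abs]
  refine (norm_integral_le_of_norm_le hint.integrableOn ?_).trans
    (setIntegral_le_integral hint (ae_of_all _ fun v => ?_))
  · filter_upwards [ae_restrict_mem hs] with v hv
    rw [Real.norm_eq_abs, abs_mul, ← mul_assoc]
    exact mul_le_mul_of_nonneg_right (h v hv) (abs_nonneg _)
  · have := (cauchyWeight_pos v).le
    simp only [Pi.zero_apply]
    positivity

/-- Comparison constant between `1 / (t - v)²` and the Cauchy weight, for `|t - v| ≥ d`. -/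
noncomputable def kernelConst (d : ℝ) : ℝ := 3 / d ^ 2 + 2

lemma kernelConst_pos (d : ℝ) : 0 < kernelConst d := by unfold kernelConst; positivity

/-- For |t| ≤ 1, 1 + v² ≤ 3 + 2(t−v)² because 2(t−v)² + 2t² − v² = (2t−v)²; the 3 is then paid for
by (t−v)² ≥ d². -/
lemma one_div_sq_le (hd : 0 < d) (ht : |t| ≤ 1) {v : ℝ} (hv : d ≤ |t - v|) :
    1 / (t - v) ^ 2 ≤ kernelConst d * cauchyWeight v := by
  have h1 : d ^ 2 ≤ (t - v) ^ 2 := by rw [← sq_abs (t - v)]; gcongr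
  have h2 : 0 < d ^ 2 := by positivity
  have h3 : 0 < (t - v) ^ 2 := by linarith
  have h4 : t ^ 2 ≤ 1 := by rw [← sq_abs]; nlinarith [abs_nonneg t]
  rw [cauchyWeight, mul_one_div, div_le_div_iff₀ h3 (by positivity), kernelConst, one_mul, add_mul]
  have h5 : 3 ≤ 3 / d ^ 2 * (t - v) ^ 2 := by
    rw [div_mul_eq_mul_div, le_div_iff₀ h2]; linarith
  nlinarith [sq_nonneg (2 * t - v)]

lemma integrableOn_normLog_div_sq (x : Fin n → ℝ) (hd : 0 < d) (ht : |t| ≤ 1)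
    (hv : ∀ v ∈ (Icc a b)ᶜ, d ≤ |t - v|) :
    IntegrableOn (fun v => 1 / (t - v) ^ 2 * normLog x v) (Icc a b)ᶜ :=
  integrableOn_mul_normLog_of_abs_le x (by fun_prop) measurableSet_Icc.compl fun v hvI => by
    rw [abs_of_nonneg (by positivity)]
    exact one_div_sq_le hd ht (hv v hvI)

lemma rho_eq (hn : 1 ≤ n) (a b : ℝ) (x : Fin n → ℝ) (t : ℝ) :
    rho a b x t = 1 / (π ^ 2 * n) * ∫ v in (Icc a b)ᶜ, 1 / (t - v) ^ 2 * normLog x v := by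
  have hn' : (n : ℝ) ≠ 0 := by positivity
  have : ∀ v : ℝ, (logPotential x v - alpha x) / (t - v) ^ 2 =
      -(1 / (n : ℝ)) * (1 / (t - v) ^ 2 * normLog x v) := fun v => by
    rw [logPotential_sub_alpha hn]; ring
  rw [rho]
  simp_rw [this]
  rw [integral_const_mul]
  field_simp

lemma abs_rho_le (hn : 1 ≤ n) (x : Fin n → ℝ) (hd : 0 < d) (ht : |t| ≤ 1)
    (hv : ∀ v ∈ (Icc a b)ᶜ, d ≤ |t - v|) {G : ℝ}
    (hG : ∫ v, cauchyWeight v * |normLog x v| ≤ G * n) :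
    |rho a b x t| ≤ kernelConst d * G := by
  have hn' : (0 : ℝ) < n := by positivity
  have hpi := Real.pi_gt_three
  have h1 := abs_setIntegral_mul_normLog_le x measurableSet_Icc.compl (kernelConst_pos d).le
    (φ := fun v => 1 / (t - v) ^ 2) fun v hvI => by
      rw [abs_of_nonneg (by positivity)]
      exact one_div_sq_le hd ht (hv v hvI)
  have h2 : |∫ v in (Icc a b)ᶜ, 1 / (t - v) ^ 2 * normLog x v| ≤ kernelConst d * (G * n) :=
    h1.trans (mul_le_mul_of_nonneg_left hG (kernelConst_pos d).le)
  rw [rho_eq hn, abs_mul, abs_of_pos (by positivity), div_mul_eq_mul_div, one_mul,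
    div_le_iff₀ (by positivity)]
  refine h2.trans ?_
  have h3 : 0 ≤ kernelConst d * (G * n) := (abs_nonneg _).trans h2
  nlinarith [mul_nonneg h3 (show 0 ≤ π ^ 2 - 1 by nlinarith)]

lemma abs_rho_sub_le (hn : 1 ≤ n) (x : Fin n → ℝ) (hd : 0 < d) {s : ℝ} (hs : |s| ≤ 1)
    (ht : |t| ≤ 1) (hvs : ∀ v ∈ (Icc a b)ᶜ, d ≤ |s - v|) (hv : ∀ v ∈ (Icc a b)ᶜ, d ≤ |t - v|)
    {G : ℝ} (hG : ∫ v, cauchyWeight v * |normLog x v| ≤ G * n) :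
    |rho a b x s - rho a b x t| ≤ 2 / d * kernelConst d * G * |s - t| := by
  have hn' : (0 : ℝ) < n := by positivity
  have hpi := Real.pi_gt_three
  set κ := |s - t| * (2 / d) * kernelConst d with hκ
  have hκ0 : 0 ≤ κ := mul_nonneg (by positivity) (kernelConst_pos d).le
  have hφ : ∀ v ∈ (Icc a b)ᶜ, |1 / (s - v) ^ 2 - 1 / (t - v) ^ 2| ≤ κ * cauchyWeight v := by
    intro v hvI
    have h1 := hvs v hvI
    have h2 := hv v hvI
    have hp : 0 < |s - v| := by linarith
    have hq : 0 < |t - v| := by linarith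
    have hp' : s - v ≠ 0 := abs_pos.1 hp
    have hq' : t - v ≠ 0 := abs_pos.1 hq
    have h3 : 1 / (s - v) ^ 2 - 1 / (t - v) ^ 2 =
        -(s - t) * (1 / ((s - v) ^ 2 * (t - v)) + 1 / ((s - v) * (t - v) ^ 2)) := by
      field_simp
      ring
    have h4 : |1 / ((s - v) ^ 2 * (t - v))| ≤ 1 / d * (1 / (s - v) ^ 2) := by
      rw [abs_div, abs_mul, abs_of_nonneg (sq_nonneg (s - v)), abs_one, one_div_mul_one_div,
        mul_comm]
      gcongr
    have h5 : |1 / ((s - v) * (t - v) ^ 2)| ≤ 1 / d * (1 / (t - v) ^ 2) := by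
      rw [abs_div, abs_mul, abs_of_nonneg (sq_nonneg (t - v)), abs_one, one_div_mul_one_div]
      gcongr
    have h6 := one_div_sq_le hd hs h1
    have h7 := one_div_sq_le hd ht h2
    rw [h3, abs_mul, abs_neg]
    calc _ ≤ |s - t| * (1 / d * (1 / (s - v) ^ 2) + 1 / d * (1 / (t - v) ^ 2)) := by
          gcongr
          exact (abs_add_le _ _).trans (add_le_add h4 h5)
      _ ≤ |s - t| * (1 / d * (kernelConst d * cauchyWeight v) +
          1 / d * (kernelConst d * cauchyWeight v)) := by gcongr
      _ = κ * cauchyWeight v := by rw [hκ]; ring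
  have h1 := abs_setIntegral_mul_normLog_le x measurableSet_Icc.compl hκ0 hφ
  have h2 := h1.trans (mul_le_mul_of_nonneg_left hG hκ0)
  have hsplit : rho a b x s - rho a b x t = 1 / (π ^ 2 * n) *
      ∫ v in (Icc a b)ᶜ, (1 / (s - v) ^ 2 - 1 / (t - v) ^ 2) * normLog x v := by
    rw [rho_eq hn, rho_eq hn, ← mul_sub, ← integral_sub (integrableOn_normLog_div_sq x hd hs hvs)
      (integrableOn_normLog_div_sq x hd ht hv)]
    simp_rw [sub_mul]
  rw [hsplit, abs_mul, abs_of_pos (by positivity), div_mul_eq_mul_div, one_mul,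
    div_le_iff₀ (by positivity)]
  refine h2.trans ?_
  have h3 : 0 ≤ κ * (G * n) := (abs_nonneg _).trans h2
  have h4 : 2 / d * kernelConst d * G * |s - t| * (π ^ 2 * n) = κ * (G * n) * π ^ 2 := by
    rw [hκ]; ring
  rw [h4]
  nlinarith [mul_nonneg h3 (show 0 ≤ π ^ 2 - 1 by nlinarith)]

/-- Outside I the negative part of h has weighted mass O(log n), so it suffices to find a fixed
window where h ≥ n. Past e^{1+c} + 1 every log(v − x_i) is at least 1 + c, which beats α ≥ −c. -/
lemma le_rho (hn : 1 ≤ n) (hx : Function.Injective x) (hmem : ∀ i, x i ∈ Icc (-1 : ℝ) 1)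
    (hb : b ≤ 1) (hd : 0 < d) (ht : |t| ≤ 1) (hv : ∀ v ∈ (Icc a b)ᶜ, d ≤ |t - v|) {c : ℝ}
    (hα : |alpha x| ≤ c) :
    1 / π ^ 2 * (1 / (Real.exp (1 + c) + 3) ^ 2 -
      kernelConst d * (2 * π * (Real.log n / n) + 2 / n ^ 2)) ≤ rho a b x t := by
  have hn0 : (0 : ℝ) < n := by positivity
  have hn1 : (1 : ℝ) ≤ n := by exact_mod_cast hn
  have hlog := Real.log_nonneg hn1
  set E := Real.exp (1 + c) with hE
  have hE0 : 0 < E := Real.exp_pos _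
  have hk := kernelConst_pos d
  set J := Icc (E + 1) (E + 2) with hJ
  have hJI : J ⊆ (Icc a b)ᶜ := fun v hv hvI => by linarith [hv.1, hvI.2]
  have hlow : ∀ᵐ v ∂(volume.restrict (Icc a b)ᶜ),
      J.indicator (fun _ => (n : ℝ) * (1 / (E + 3) ^ 2)) v -
        kernelConst d * (2 * Real.log n * cauchyWeight v + nodeCap x v) ≤
      1 / (t - v) ^ 2 * normLog x v := by
    filter_upwards [ae_restrict_of_ae (ae_ne_nodes x), ae_restrict_mem measurableSet_Icc.compl]
      with v hvx hvI
    have h1 := one_div_sq_le hd ht (hv v hvI)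
    have hw := cauchyWeight_pos v
    have hw1 : cauchyWeight v ≤ 1 := by
      rw [cauchyWeight, div_le_one (by positivity)]; nlinarith
    have hc := nodeCap_nonneg x v
    have h0 : 0 ≤ 1 / (t - v) ^ 2 := by positivity
    by_cases hvJ : v ∈ J
    · rw [indicator_of_mem hvJ]
      have h2 : (n : ℝ) ≤ normLog x v := by
        have h3 : ∀ i, 1 + c ≤ Real.log (v - x i) := fun i => by
          rw [Real.le_log_iff_exp_le (by linarith [hvJ.1, (hmem i).2]), ← hE]
          linarith [hvJ.1, (hmem i).2]
        have h4 : n * (1 + c) ≤ ∑ i, Real.log (v - x i) := by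
          calc (n : ℝ) * (1 + c) = ∑ _i : Fin n, (1 + c) := by simp; ring
            _ ≤ _ := Finset.sum_le_sum fun i _ => h3 i
        have h5 : -c ≤ alpha x := (abs_le.1 hα).1
        have h6 : n * -c ≤ n * alpha x := mul_le_mul_of_nonneg_left h5 hn0.le
        rw [normLog]
        linarith
      have h3 : 1 / (E + 3) ^ 2 ≤ 1 / (t - v) ^ 2 := by
        have htv := hv v hvI
        have h4 : |t - v| ≤ E + 3 := abs_le.2
          ⟨by linarith [hvJ.2, (abs_le.1 ht).1], by linarith [hvJ.1, (abs_le.1 ht).2]⟩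
        rw [← sq_abs (t - v)]
        have : 0 < |t - v| := by linarith
        gcongr
      have h4 : (n : ℝ) * (1 / (E + 3) ^ 2) ≤ 1 / (t - v) ^ 2 * normLog x v := by
        rw [mul_comm (n : ℝ)]
        gcongr
      have h5 : 0 ≤ kernelConst d * (2 * Real.log n * cauchyWeight v + nodeCap x v) := by
        positivity
      linarith
    · rw [indicator_of_notMem hvJ]
      have h2 := neg_nodeCap_le_normLog hn hx hvx
      have h3 : 1 / (t - v) ^ 2 * (2 * Real.log n + nodeCap x v) ≤
          kernelConst d * (2 * Real.log n * cauchyWeight v + nodeCap x v) := by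
        have h4 : 1 / (t - v) ^ 2 ≤ kernelConst d :=
          h1.trans (mul_le_of_le_one_right hk.le hw1)
        rw [mul_add, mul_add]
        refine add_le_add ?_ (by gcongr)
        calc _ ≤ (kernelConst d * cauchyWeight v) * (2 * Real.log n) := by gcongr
          _ = _ := by ring
      have h5 : 1 / (t - v) ^ 2 * (-(2 * Real.log n) - nodeCap x v) ≤
          1 / (t - v) ^ 2 * normLog x v := mul_le_mul_of_nonneg_left h2 h0
      linarith
  have hi1 : Integrable (J.indicator (fun _ => (n : ℝ) * (1 / (E + 3) ^ 2))) :=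
    (integrable_indicator_iff measurableSet_Icc).2 (integrableOn_const (by simp))
  have hi2 : Integrable (fun v => kernelConst d *
      (2 * Real.log n * cauchyWeight v + nodeCap x v)) :=
    ((integrable_cauchyWeight.const_mul _).add (integrable_nodeCap hn x)).const_mul _
  have h1 := integral_mono_ae (hi1.integrableOn.sub hi2.integrableOn)
    (integrableOn_normLog_div_sq x hd ht hv) hlow
  simp only [Pi.sub_apply] at h1
  rw [integral_sub hi1.integrableOn hi2.integrableOn] at h1
  have h2 : ∫ v in (Icc a b)ᶜ, J.indicator (fun _ => (n : ℝ) * (1 / (E + 3) ^ 2)) v =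
      n * (1 / (E + 3) ^ 2) := by
    rw [setIntegral_indicator measurableSet_Icc, inter_eq_self_of_subset_right hJI,
      setIntegral_const, hJ, Real.volume_real_Icc_of_le (by linarith)]
    simp
    ring
  have h3 : ∫ v in (Icc a b)ᶜ, kernelConst d * (2 * Real.log n * cauchyWeight v + nodeCap x v) ≤
      kernelConst d * (2 * Real.log n * π + 2 / n) := by
    refine (setIntegral_le_integral hi2 (ae_of_all _ fun v => ?_)).trans (le_of_eq ?_)
    · have := cauchyWeight_pos v
      have := nodeCap_nonneg x v
      simp only [Pi.zero_apply]
      positivity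
    · rw [integral_const_mul, integral_add (integrable_cauchyWeight.const_mul _)
        (integrable_nodeCap hn x), integral_const_mul, integral_cauchyWeight,
        integral_nodeCap hn x]
  rw [h2] at h1
  rw [rho_eq hn]
  calc _ = 1 / (π ^ 2 * n) * (n * (1 / (E + 3) ^ 2) -
        kernelConst d * (2 * Real.log n * π + 2 / n)) := by field_simp
    _ ≤ _ := by
      gcongr
      linarith

/-- The part of the Poisson integral of `normLog` coming from `[a, b]`. -/
noncomputable def innerPoisson (a b : ℝ) (x : Fin n → ℝ) (t η : ℝ) : ℝ :=
  1 / π * ∫ v in Icc a b, η / ((v - t) ^ 2 + η ^ 2) * normLog x v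

lemma integrable_poisson_mul_normLog (x : Fin n → ℝ) (t : ℝ) {η : ℝ} (hη : 0 < η) :
    Integrable (fun v => η / ((v - t) ^ 2 + η ^ 2) * normLog x v) := by
  simp_rw [normLog, mul_add, Finset.mul_sum]
  exact ((integrable_poisson hη).mul_const _).add
    (integrable_finsetSum _ fun i _ => integrable_poisson_log hη (x i))

lemma integral_poisson_mul_normLog (x : Fin n → ℝ) (t : ℝ) {η : ℝ} (hη : 0 < η) :
    ∫ v, η / ((v - t) ^ 2 + η ^ 2) * normLog x v =
      π * (n * alpha x + ∑ i, Real.log ‖(t + η * Complex.I - x i : ℂ)‖) := by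
  simp_rw [normLog, mul_add, Finset.mul_sum]
  rw [integral_add ((integrable_poisson hη).mul_const _)
    (integrable_finsetSum _ fun i _ => integrable_poisson_log hη (x i)),
    integral_mul_const, integral_poisson hη,
    integral_finsetSum _ fun i _ => integrable_poisson_log hη (x i)]
  simp_rw [integral_poisson_log hη]

/-- Outside I the Poisson kernel differs from η/(t−v)² by at most (η³/d²)/(t−v)². The leading term
integrates to π · πnηρ(t), and the error meets the weighted L¹ bound. -/
lemma abs_sum_log_sub_le (hn : 1 ≤ n) (x : Fin n → ℝ) (hd : 0 < d) (ht : |t| ≤ 1)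
    (hv : ∀ v ∈ (Icc a b)ᶜ, d ≤ |t - v|) {G : ℝ}
    (hG : ∫ v, cauchyWeight v * |normLog x v| ≤ G * n) {η : ℝ} (hη : 0 < η) :
    |n * alpha x + ∑ i, Real.log ‖(t + η * Complex.I - x i : ℂ)‖ - π * n * η * rho a b x t -
      innerPoisson a b x t η| ≤ kernelConst d / d ^ 2 * G * n * η ^ 3 := by
  have hn0 : (0 : ℝ) < n := by positivity
  have hpi := Real.pi_gt_three
  have hk := kernelConst_pos d
  set κ := η ^ 3 / d ^ 2 * kernelConst d with hκ
  have hκ0 : 0 ≤ κ := by positivity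
  have hφ : ∀ v ∈ (Icc a b)ᶜ, |η / ((v - t) ^ 2 + η ^ 2) - η * (1 / (t - v) ^ 2)| ≤
      κ * cauchyWeight v := by
    intro v hvI
    have h1 := hv v hvI
    have h2 : 0 < |t - v| := by linarith
    have h3 : t - v ≠ 0 := abs_pos.1 h2
    have h4 : 0 < (t - v) ^ 2 := by positivity
    have h5 : d ^ 2 ≤ (t - v) ^ 2 := by rw [← sq_abs (t - v)]; gcongr
    have h6 : η / ((v - t) ^ 2 + η ^ 2) - η * (1 / (t - v) ^ 2) =
        -(η ^ 3 / ((t - v) ^ 2 + η ^ 2) * (1 / (t - v) ^ 2)) := by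
      rw [show (v - t) ^ 2 = (t - v) ^ 2 by ring]
      field_simp
      ring
    rw [h6, abs_neg, abs_of_nonneg (by positivity), hκ, mul_assoc]
    refine mul_le_mul ?_ (one_div_sq_le hd ht h1) (by positivity) (by positivity)
    gcongr
    nlinarith
  have hi := integrable_poisson_mul_normLog x t hη
  have h1 := integral_add_compl (measurableSet_Icc (a := a) (b := b)) hi
  rw [integral_poisson_mul_normLog x t hη] at h1
  have h2 : ∫ v in (Icc a b)ᶜ, (η / ((v - t) ^ 2 + η ^ 2) - η * (1 / (t - v) ^ 2)) * normLog x v =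
      (∫ v in (Icc a b)ᶜ, η / ((v - t) ^ 2 + η ^ 2) * normLog x v) -
        η * ∫ v in (Icc a b)ᶜ, 1 / (t - v) ^ 2 * normLog x v := by
    rw [← integral_const_mul, ← integral_sub hi.integrableOn
      ((integrableOn_normLog_div_sq x hd ht hv).const_mul η)]
    simp_rw [sub_mul, mul_assoc]
  have h3 := (abs_setIntegral_mul_normLog_le x measurableSet_Icc.compl hκ0 hφ).trans
    (mul_le_mul_of_nonneg_left hG hκ0)
  rw [h2] at h3
  have h4 : η * ∫ v in (Icc a b)ᶜ, 1 / (t - v) ^ 2 * normLog x v =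
      π * (π * n * η * rho a b x t) := by
    rw [rho_eq hn]; field_simp
  rw [h4] at h3
  have h5 : π * innerPoisson a b x t η =
      ∫ v in Icc a b, η / ((v - t) ^ 2 + η ^ 2) * normLog x v := by
    rw [innerPoisson]; field_simp
  rw [← h5] at h1
  have h6 : (∫ v in (Icc a b)ᶜ, η / ((v - t) ^ 2 + η ^ 2) * normLog x v) -
      π * (π * n * η * rho a b x t) = π * (n * alpha x +
      ∑ i, Real.log ‖(t + η * Complex.I - x i : ℂ)‖ - π * n * η * rho a b x t -
      innerPoisson a b x t η) := by linarith
  rw [h6, abs_mul, abs_of_pos Real.pi_pos] at h3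
  have h7 : kernelConst d / d ^ 2 * G * n * η ^ 3 = κ * (G * n) := by rw [hκ]; ring
  rw [h7]
  refine le_trans ?_ h3
  exact le_mul_of_one_le_left (abs_nonneg _) (by linarith)

lemma setIntegral_poisson_le {η : ℝ} (hη : 0 < η) (t : ℝ) (s : Set ℝ) :
    ∫ v in s, η / ((v - t) ^ 2 + η ^ 2) ≤ π := by
  rw [← integral_poisson (t := t) hη]
  exact setIntegral_le_integral (integrable_poisson hη) (ae_of_all _ fun v => by
    simp only [Pi.zero_apply]; positivity)

/-- On I, |h| ≤ (C+2) log n + `nodeCap`. The first term meets kernel mass at most π, the second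
kernel height at most 1/η. -/
lemma abs_innerPoisson_le (hn : 1 ≤ n) (hx : Function.Injective x) {C : ℝ} (hC : 0 ≤ C)
    (h : ∀ v ∈ Icc a b, |(nodePoly x).eval v| * Real.exp (n * alpha x) ≤ (n : ℝ) ^ C)
    {η : ℝ} (hη : 0 < η) :
    |innerPoisson a b x t η| ≤ (C + 2) * Real.log n + 1 / (n * η) := by
  have hn0 : (0 : ℝ) < n := by positivity
  have hn1 : (1 : ℝ) ≤ n := by exact_mod_cast hn
  have hlog := Real.log_nonneg hn1
  have hpi := Real.pi_gt_three
  have hle : ∀ᵐ v ∂(volume.restrict (Icc a b)), ‖η / ((v - t) ^ 2 + η ^ 2) * normLog x v‖ ≤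
      η / ((v - t) ^ 2 + η ^ 2) * ((C + 2) * Real.log n) + 1 / η * nodeCap x v := by
    filter_upwards [ae_restrict_of_ae (ae_ne_nodes x), ae_restrict_mem measurableSet_Icc]
      with v hvx hvI
    have h1 := neg_nodeCap_le_normLog hn hx hvx
    have h2 := normLog_le hn hvx (h v hvI)
    have h3 := nodeCap_nonneg x v
    have h4 : |normLog x v| ≤ (C + 2) * Real.log n + nodeCap x v :=
      abs_le.2 ⟨by nlinarith, by nlinarith⟩
    have h5 : η / ((v - t) ^ 2 + η ^ 2) ≤ 1 / η := by
      rw [div_le_div_iff₀ (by positivity) hη]; nlinarith [sq_nonneg (v - t)]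
    rw [norm_mul, Real.norm_eq_abs, Real.norm_eq_abs, abs_of_nonneg (by positivity)]
    calc _ ≤ η / ((v - t) ^ 2 + η ^ 2) * ((C + 2) * Real.log n + nodeCap x v) := by gcongr
      _ ≤ _ := by rw [mul_add]; gcongr
  have hi1 := (integrable_poisson (t := t) hη).mul_const ((C + 2) * Real.log n)
  have hi2 := (integrable_nodeCap hn x).const_mul (1 / η)
  have h1 := norm_integral_le_of_norm_le (hi1.integrableOn.add hi2.integrableOn) hle
  simp only [Pi.add_apply] at h1
  rw [integral_add hi1.integrableOn hi2.integrableOn, integral_mul_const, integral_const_mul] at h1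
  have h2 : ∫ v in Icc a b, nodeCap x v ≤ 2 / n := by
    rw [← integral_nodeCap hn x]
    exact setIntegral_le_integral (integrable_nodeCap hn x) (ae_of_all _ fun v =>
      nodeCap_nonneg x v)
  have h3 : ‖∫ v in Icc a b, η / ((v - t) ^ 2 + η ^ 2) * normLog x v‖ ≤
      π * ((C + 2) * Real.log n) + 1 / η * (2 / n) := by
    refine h1.trans (add_le_add ?_ (by gcongr))
    have := setIntegral_poisson_le hη t (Icc a b)
    gcongr
  rw [innerPoisson, abs_mul, ← Real.norm_eq_abs (∫ _ in _, _), abs_of_pos (by positivity)]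
  calc _ ≤ 1 / π * (π * ((C + 2) * Real.log n) + 1 / η * (2 / n)) := by gcongr
    _ = (C + 2) * Real.log n + 2 / π * (1 / (n * η)) := by field_simp
    _ ≤ _ := by
      have h4 : 2 / π ≤ 1 := by rw [div_le_one (by positivity)]; linarith
      have h5 : 0 ≤ 1 / (n * η) := by positivity
      nlinarith

/-- The bound is deliberately crude: |u| ≤ k/2 + u²/(2k) with k = √η balances the kernel mass π
against the bound η for kernel times u². -/
lemma setIntegral_poisson_mul_abs_sub_le {η : ℝ} (hη : 0 < η) (t : ℝ) (hab : a ≤ b)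
    (hba : b - a ≤ 2) :
    ∫ v in Icc a b, η / ((v - t) ^ 2 + η ^ 2) * |v - t| ≤ 3 * √η := by
  set k := √η with hk
  have hk0 : 0 < k := Real.sqrt_pos.2 hη
  have hkk : k * k = η := Real.mul_self_sqrt hη.le
  have hi1 := ((integrable_poisson (t := t) hη).mul_const (k / 2)).integrableOn (s := Icc a b)
  have hi2 : IntegrableOn (fun _ : ℝ => k / 2) (Icc a b) := integrableOn_const (by simp)
  have hint : IntegrableOn (fun v => η / ((v - t) ^ 2 + η ^ 2) * |v - t|) (Icc a b) := by
    refine ContinuousOn.integrableOn_compact isCompact_Icc (Continuous.continuousOn ?_)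
    refine Continuous.mul (continuous_const.div (by fun_prop) fun v => by positivity) (by fun_prop)
  have h1 : ∫ v in Icc a b, η / ((v - t) ^ 2 + η ^ 2) * |v - t| ≤
      ∫ v in Icc a b, (η / ((v - t) ^ 2 + η ^ 2) * (k / 2) + k / 2) := by
    refine integral_mono hint (hi1.add hi2) fun v => ?_
    simp only []
    set u := |v - t| with hu
    have hu2 : (v - t) ^ 2 = u ^ 2 := (sq_abs _).symm
    rw [hu2]
    have h2 : u ≤ k / 2 + u ^ 2 / (2 * k) := by
      have h3 : 0 ≤ (u - k) ^ 2 / (2 * k) := by positivity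
      have h4 : (u - k) ^ 2 / (2 * k) = k / 2 + u ^ 2 / (2 * k) - u := by field_simp; ring
      linarith
    have h5 : η / (u ^ 2 + η ^ 2) * (u ^ 2 / (2 * k)) ≤ k / 2 := by
      rw [div_mul_div_comm, div_le_div_iff₀ (by positivity) two_pos, ← hkk]
      have : 0 ≤ k * (2 * k) * (k * k) ^ 2 := by positivity
      nlinarith
    calc _ ≤ η / (u ^ 2 + η ^ 2) * (k / 2 + u ^ 2 / (2 * k)) := by gcongr
      _ ≤ _ := by rw [mul_add]; gcongr
  refine h1.trans ?_
  rw [integral_add hi1 hi2, integral_mul_const, setIntegral_const,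
    Real.volume_real_Icc_of_le hab, smul_eq_mul]
  have h2 := setIntegral_poisson_le hη t (Icc a b)
  have h3 := Real.pi_lt_four
  nlinarith

/-- The log-Lipschitz bound gives h(v) ≤ D + n^{0.1}|v−t| on I. The kernel mass on I misses π by
O(η), and since D may have either sign this costs |D|η. -/
lemma innerPoisson_le (hn : 1 ≤ n) (ha : -1 ≤ a) (hab : a < b) (hb : b ≤ 1) (hd : 0 < d)
    (ht : |t| ≤ 1) (hv : ∀ v ∈ (Icc a b)ᶜ, d ≤ |t - v|) {η : ℝ} (hη : 0 < η) {D : ℝ}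
    (hD : Real.exp D = amplitude a b x t * Real.exp (n * alpha x)) :
    innerPoisson a b x t η ≤ D + (n : ℝ) ^ (0.1 : ℝ) * √η + kernelConst d * |D| * η := by
  have hn0 : (0 : ℝ) < n := by positivity
  have hpi := Real.pi_gt_three
  set y := (n : ℝ) ^ (0.1 : ℝ) with hy
  have hy0 : 0 < y := by positivity
  set p : ℝ → ℝ := fun v => η / ((v - t) ^ 2 + η ^ 2) with hp
  have hp0 : ∀ v, 0 ≤ p v := fun v => by simp only [hp]; positivity
  have hpi_int : Integrable p := integrable_poisson hη
  have hint : IntegrableOn (fun v => p v * |v - t|) (Icc a b) := by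
    refine ContinuousOn.integrableOn_compact isCompact_Icc (Continuous.continuousOn ?_)
    refine Continuous.mul (continuous_const.div (by fun_prop) fun v => by positivity) (by fun_prop)
  have hle : ∀ᵐ v ∂(volume.restrict (Icc a b)), p v * normLog x v ≤
      p v * D + y * (p v * |v - t|) := by
    filter_upwards [ae_restrict_of_ae (ae_ne_nodes x), ae_restrict_mem measurableSet_Icc]
      with v hvx hvI
    have h1 : normLog x v ≤ D + y * |v - t| := by
      rw [← Real.exp_le_exp, exp_normLog hvx, Real.exp_add, hD]
      calc _ ≤ amplitude a b x v * Real.exp (n * alpha x) := by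
            gcongr; exact abs_eval_le_amplitude x hvI
        _ ≤ Real.exp (y * |v - t|) * amplitude a b x t * Real.exp (n * alpha x) := by
            gcongr; exact amplitude_le_exp_mul_amplitude hab.le x v t
        _ = _ := by ring
    calc _ ≤ p v * (D + y * |v - t|) := mul_le_mul_of_nonneg_left h1 (hp0 v)
      _ = _ := by ring
  have h1 := integral_mono_ae (integrable_poisson_mul_normLog x t hη).integrableOn
    ((hpi_int.mul_const D).integrableOn.add (hint.const_mul y)) hle
  simp only [Pi.add_apply] at h1
  rw [integral_add (hpi_int.mul_const D).integrableOn (hint.const_mul y), integral_mul_const,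
    integral_const_mul] at h1
  have h2 := setIntegral_poisson_mul_abs_sub_le hη t hab.le (by linarith)
  have h3 := integral_add_compl (measurableSet_Icc (a := a) (b := b)) hpi_int
  rw [integral_poisson hη] at h3
  have h4 : ∫ v in (Icc a b)ᶜ, p v ≤ η * kernelConst d * π := by
    have hi := integrable_cauchyWeight.const_mul (η * kernelConst d)
    have hk := kernelConst_pos d
    calc _ ≤ ∫ v in (Icc a b)ᶜ, η * kernelConst d * cauchyWeight v := by
          refine setIntegral_mono_on hpi_int.integrableOn hi.integrableOn
            measurableSet_Icc.compl fun v hvI => ?_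
          have h5 := one_div_sq_le hd ht (hv v hvI)
          have h6 : 0 < |t - v| := hd.trans_le (hv v hvI)
          have h7 : 0 < (t - v) ^ 2 := by rw [← sq_abs]; positivity
          rw [mul_assoc]
          refine le_trans ?_ (mul_le_mul_of_nonneg_left h5 hη.le)
          simp only [hp]
          rw [mul_one_div, show (v - t) ^ 2 = (t - v) ^ 2 by ring]
          gcongr
          linarith [sq_nonneg η]
      _ ≤ ∫ v, η * kernelConst d * cauchyWeight v :=
          setIntegral_le_integral hi (ae_of_all _ fun v => by
            have := cauchyWeight_pos v
            simp only [Pi.zero_apply]; positivity)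
      _ = _ := by rw [integral_const_mul, integral_cauchyWeight]
  have h5 : 0 ≤ ∫ v in (Icc a b)ᶜ, p v := integral_nonneg hp0
  have h6 : (∫ v in Icc a b, p v) * D ≤ π * D + η * kernelConst d * π * |D| := by
    have h7 : ∫ v in Icc a b, p v = π - ∫ v in (Icc a b)ᶜ, p v := by linarith
    rw [h7, sub_mul]
    have h8 : -((∫ v in (Icc a b)ᶜ, p v) * |D|) ≤ (∫ v in (Icc a b)ᶜ, p v) * D := by
      rw [← mul_neg]; exact mul_le_mul_of_nonneg_left (neg_abs_le D) h5
    have h9 := mul_le_mul_of_nonneg_right h4 (abs_nonneg D)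
    linarith
  have h7 : y * ∫ v in Icc a b, p v * |v - t| ≤ y * (3 * √η) := by gcongr
  rw [innerPoisson, div_mul_eq_mul_div, one_mul, div_le_iff₀ (by positivity)]
  have h8 : 0 ≤ y * √η := by positivity
  refine h1.trans ?_
  nlinarith

end

/-! ### Interior estimates for ρ, U and P off the real axis. -/

section

/-- The estimates for the density and for the Poisson decomposition of the potential. -/
theorem density_estimates (a b K B : ℝ) (ha : -1 ≤ a) (hab : a < b) (hb : b ≤ 1) {a' b' : ℝ}
    (ha' : a < a') (hb' : b' < b) :
    ∃ C : ℝ, 1 ≤ C ∧ ∃ N : ℕ, ∀ n : ℕ, N ≤ n → ∀ x : Fin n → ℝ, GoodNodes a b K B x →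
      (∀ t ∈ Icc a' b', C⁻¹ ≤ rho a b x t ∧ rho a b x t ≤ C) ∧
      (∀ s ∈ Icc a' b', ∀ t ∈ Icc a' b', |rho a b x s - rho a b x t| ≤ C * |s - t|) ∧
      (∀ t ∈ Icc a' b', ∀ η : ℝ, 0 < η →
        |n * alpha x + ∑ i, Real.log ‖(t + η * Complex.I - x i : ℂ)‖ - π * n * η * rho a b x t -
          innerPoisson a b x t η| ≤ C * n * η ^ 3 ∧
        (Real.log n / n ≤ η → |innerPoisson a b x t η| ≤ C * Real.log n) ∧
        innerPoisson a b x t η ≤ Real.log (amplitude a b x t * Real.exp (n * alpha x)) +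
          (n : ℝ) ^ (0.1 : ℝ) * √η + C * Real.log n * η) ∧
      (∀ t ∈ Icc a' b', 0 < amplitude a b x t ∧
        |Real.log (amplitude a b x t * Real.exp (n * alpha x))| ≤ C * Real.log n) := by
  obtain ⟨C₁, hC₁, h₁⟩ := exists_abs_eval_mul_exp_le K B ha hb
  obtain ⟨C₂, hC₂, h₂⟩ := exists_abs_alpha_le K B ha hab hb
  obtain ⟨C₃, hC₃, N₃, h₃⟩ := exists_amplitude_bounds K B ha hab hb
  set d := min (a' - a) (b - b') with hd_def
  have hd : 0 < d := lt_min (by linarith) (by linarith)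
  have hk := kernelConst_pos d
  have hpi := Real.pi_pos
  set G := (C₂ + 3) * π with hG_def
  have hG0 : 0 < G := by positivity
  set c := 1 / π ^ 2 * (1 / (Real.exp (1 + C₂) + 3) ^ 2) with hc_def
  have hc0 : 0 < c := by positivity
  have htend : Tendsto (fun n : ℕ => 1 / π ^ 2 * (1 / (Real.exp (1 + C₂) + 3) ^ 2 -
      kernelConst d * (2 * π * (Real.log n / n) + 2 / (n : ℝ) ^ 2))) atTop (𝓝 c) := by
    have h1 : Tendsto (fun n : ℕ => Real.log n / n) atTop (𝓝 0) :=
      Real.isLittleO_log_id_atTop.tendsto_div_nhds_zero.comp tendsto_natCast_atTop_atTop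
    have h2 : Tendsto (fun n : ℕ => 2 / (n : ℝ) ^ 2) atTop (𝓝 0) :=
      tendsto_const_nhds.div_atTop
        ((tendsto_pow_atTop two_ne_zero).comp tendsto_natCast_atTop_atTop)
    have h3 := (((h1.const_mul (2 * π)).add h2).const_mul (kernelConst d)).const_sub
      (1 / (Real.exp (1 + C₂) + 3) ^ 2)
    have h4 := h3.const_mul (1 / π ^ 2)
    simpa [hc_def] using h4
  -- From here on the lower bound for ρ exceeds half its limit c, hence the summand 2/c in the final
  -- constant.
  obtain ⟨N₄, hN₄⟩ := eventually_atTop.1 (htend.eventually_const_le (half_lt_self hc0))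
  set C := kernelConst d * G + 2 / d * kernelConst d * G + kernelConst d / d ^ 2 * G + 2 / c +
    (C₁ + 3) + kernelConst d * C₃ + C₃ with hC
  have e1 : 0 < kernelConst d * G := by positivity
  have e2 : 0 < 2 / d * kernelConst d * G := by positivity
  have e3 : 0 < kernelConst d / d ^ 2 * G := by positivity
  have e4 : 0 < 2 / c := by positivity
  have e5 : 0 < kernelConst d * C₃ := by positivity
  refine ⟨C, by linarith, N₃ + N₄ + 3, fun n hn x hx => ?_⟩
  have hn1 : 1 ≤ n := by omega
  have hn0 : (0 : ℝ) < n := by exact_mod_cast (by omega : 0 < n)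
  have hn1' : (1 : ℝ) ≤ n := by exact_mod_cast hn1
  have hlog1 : 1 ≤ Real.log n := by
    rw [Real.le_log_iff_exp_le hn0]
    have : (3 : ℝ) ≤ n := by exact_mod_cast (by omega : 3 ≤ n)
    linarith [Real.exp_one_lt_d9]
  have hα := h₂ n (by omega) x hx
  have hG : ∫ v, cauchyWeight v * |normLog x v| ≤ G * n := by
    refine (integral_cauchyWeight_mul_abs_normLog_le hx.mem_Icc).trans ?_
    rw [hG_def]
    gcongr
  have hI : ∀ t ∈ Icc a' b', t ∈ Icc a b := fun t ht => ⟨by linarith [ht.1], by linarith [ht.2]⟩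
  have habs : ∀ t ∈ Icc a' b', |t| ≤ 1 := fun t ht =>
    abs_le.2 ⟨by linarith [ht.1], by linarith [ht.2]⟩
  have hv : ∀ t ∈ Icc a' b', ∀ v ∈ (Icc a b)ᶜ, d ≤ |t - v| := by
    intro t ht v hvI
    rw [mem_compl_iff, mem_Icc, not_and_or, not_le, not_le] at hvI
    rcases hvI with h | h
    · refine (min_le_left _ _).trans (le_trans ?_ (le_abs_self _))
      linarith [ht.1]
    · refine (min_le_right _ _).trans (le_trans ?_ (neg_le_abs _))
      linarith [ht.2]
  have hA : ∀ t ∈ Icc a' b', 0 < amplitude a b x t * Real.exp (n * alpha x) := fun t ht =>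
    lt_of_lt_of_le (by positivity) (h₃ n (by omega) x hx t (hI t ht)).1
  have hlogA : ∀ t ∈ Icc a' b', |Real.log (amplitude a b x t * Real.exp (n * alpha x))| ≤
      C₃ * Real.log n := fun t ht => by
    obtain ⟨h4, h5⟩ := h₃ n (by omega) x hx t (hI t ht)
    have h6 := Real.log_le_log (by positivity) h4
    have h7 := Real.log_le_log (hA t ht) h5
    rw [Real.log_rpow hn0] at h6 h7
    exact abs_le.2 ⟨by linarith, h7⟩
  refine ⟨fun t ht => ⟨?_, ?_⟩, fun s hs t ht => ?_, fun t ht η hη => ⟨?_, fun hηn => ?_, ?_⟩,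
    fun t ht => ⟨?_, ?_⟩⟩
  · refine le_trans ?_ ((hN₄ n (by omega)).trans (le_rho hn1 hx.injective hx.mem_Icc hb hd
      (habs t ht) (hv t ht) hα))
    rw [show c / 2 = (2 / c)⁻¹ by rw [inv_div]]
    exact inv_anti₀ e4 (by linarith)
  · refine (le_abs_self _).trans ((abs_rho_le hn1 x hd (habs t ht) (hv t ht) hG).trans ?_)
    linarith
  · refine (abs_rho_sub_le hn1 x hd (habs s hs) (habs t ht) (hv s hs) (hv t ht) hG).trans ?_
    gcongr
    linarith
  · refine (abs_sum_log_sub_le hn1 x hd (habs t ht) (hv t ht) hG hη).trans ?_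
    gcongr
    linarith
  · refine (abs_innerPoisson_le hn1 hx.injective (by linarith : 0 ≤ C₁)
      (h₁ n (by omega) x hx) hη).trans ?_
    have h4 : 1 / (n * η) ≤ 1 := by
      rw [div_le_iff₀ hn0] at hηn
      rw [div_le_one (by positivity)]
      linarith
    have h5 : (C₁ + 3) * Real.log n ≤ C * Real.log n := by gcongr; linarith
    linarith
  · have h4 := innerPoisson_le hn1 ha hab hb hd (habs t ht) (hv t ht) hη
      (Real.exp_log (hA t ht))
    refine h4.trans (add_le_add le_rfl (mul_le_mul_of_nonneg_right ?_ hη.le))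
    calc _ ≤ kernelConst d * (C₃ * Real.log n) := by gcongr; exact hlogA t ht
      _ = (kernelConst d * C₃) * Real.log n := by ring
      _ ≤ _ := by gcongr; linarith
  · exact pos_of_mul_pos_left (hA t ht) (Real.exp_pos _).le
  · refine (hlogA t ht).trans ?_
    gcongr
    linarith

variable {n : ℕ} {x : Fin n → ℝ}

lemma norm_add_mul_I_sub_ofReal_pos {η : ℝ} (hη : 0 < η) (t y : ℝ) :
    0 < ‖(t + η * Complex.I - y : ℂ)‖ := by
  refine norm_pos_iff.2 fun h => hη.ne' ?_
  simpa using congrArg Complex.im h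

lemma log_norm_nodePolyC {η : ℝ} (hη : 0 < η) (x : Fin n → ℝ) (t : ℝ) :
    Real.log ‖nodePolyC x (t + η * Complex.I)‖ =
      ∑ i, Real.log ‖(t + η * Complex.I - x i : ℂ)‖ := by
  rw [nodePolyC_eq, norm_prod,
    Real.log_prod fun i _ => (norm_add_mul_I_sub_ofReal_pos hη t (x i)).ne']

lemma norm_nodePolyC_pos {η : ℝ} (hη : 0 < η) (x : Fin n → ℝ) (t : ℝ) :
    0 < ‖nodePolyC x (t + η * Complex.I)‖ := by
  rw [nodePolyC_eq, norm_prod]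
  exact Finset.prod_pos fun i _ => norm_add_mul_I_sub_ofReal_pos hη t (x i)

lemma norm_sub_mul_I_sub_ofReal (t η y : ℝ) :
    ‖(t - η * Complex.I - y : ℂ)‖ = ‖(t + η * Complex.I - y : ℂ)‖ := by
  rw [← Complex.norm_conj]
  congr 1
  simp

lemma norm_nodePolyC_neg (x : Fin n → ℝ) (t η : ℝ) :
    ‖nodePolyC x (t - η * Complex.I)‖ = ‖nodePolyC x (t + η * Complex.I)‖ := by
  simp only [nodePolyC_eq, norm_prod, norm_sub_mul_I_sub_ofReal]

lemma logPotential_neg (x : Fin n → ℝ) (t η : ℝ) :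
    logPotential x (t - η * Complex.I) = logPotential x (t + η * Complex.I) := by
  simp only [logPotential_eq, norm_sub_mul_I_sub_ofReal]

/-- The potential off the real axis. -/
theorem logPotential_estimate (a b K B : ℝ) (ha : -1 ≤ a) (hab : a < b) (hb : b ≤ 1) {a' b' : ℝ}
    (ha' : a < a') (hb' : b' < b) :
    ∃ C : ℝ, 1 ≤ C ∧ ∃ N : ℕ, ∀ n : ℕ, N ≤ n → ∀ x : Fin n → ℝ, GoodNodes a b K B x →
      ∀ t ∈ Icc a' b', ∀ η : ℝ, Real.log n / n ≤ η →
        |logPotential x (t + η * Complex.I) - (alpha x - π * η * rho a b x t)| ≤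
          C * (Real.log n / n + η ^ 3) := by
  obtain ⟨C, hC, N, h⟩ := density_estimates a b K B ha hab hb ha' hb'
  refine ⟨C, hC, N + 2, fun n hn x hx t ht η hη => ?_⟩
  obtain ⟨-, -, h1, -⟩ := h n (by omega) x hx
  have hn0 : (0 : ℝ) < n := by exact_mod_cast (by omega : 0 < n)
  have hlog : 0 < Real.log n := Real.log_pos (by exact_mod_cast (by omega : 1 < n))
  have hη0 : 0 < η := lt_of_lt_of_le (by positivity) hη
  obtain ⟨h2, h3, -⟩ := h1 t ht η hη0
  have h3 := h3 hη
  have h4 : logPotential x (t + η * Complex.I) - (alpha x - π * η * rho a b x t) =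
      -(1 / (n : ℝ)) * ((n * alpha x + ∑ i, Real.log ‖(t + η * Complex.I - x i : ℂ)‖ -
        π * n * η * rho a b x t - innerPoisson a b x t η) + innerPoisson a b x t η) := by
    rw [logPotential_eq]
    field_simp
    ring
  rw [h4, abs_mul, abs_neg, abs_of_pos (by positivity)]
  calc _ ≤ 1 / (n : ℝ) * (C * n * η ^ 3 + C * Real.log n) := by
        gcongr
        exact (abs_add_le _ _).trans (add_le_add h2 h3)
    _ = _ := by field_simp; ring

/-- Two-sided bounds for the node polynomial at height at least `log n / n`. -/
theorem norm_nodePolyC_two_sided (a b K B : ℝ) (ha : -1 ≤ a) (hab : a < b) (hb : b ≤ 1)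
    {a' b' : ℝ} (ha' : a < a') (hb' : b' < b) :
    ∃ C : ℝ, 1 ≤ C ∧ ∃ N : ℕ, ∀ n : ℕ, N ≤ n → ∀ x : Fin n → ℝ, GoodNodes a b K B x →
      ∀ t ∈ Icc a' b', ∀ η : ℝ, Real.log n / n ≤ η → η ≤ (n : ℝ) ^ (-0.4 : ℝ) →
        (n : ℝ) ^ (-C) * amplitude a b x t * Real.exp (π * n * η * rho a b x t) ≤
            ‖nodePolyC x (t + η * Complex.I)‖ ∧
          ‖nodePolyC x (t + η * Complex.I)‖ ≤
            (n : ℝ) ^ C * amplitude a b x t * Real.exp (π * n * η * rho a b x t) := by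
  obtain ⟨C, hC, N, h⟩ := density_estimates a b K B ha hab hb ha' hb'
  -- Three errors of size C log n: the Poisson remainder, the part over I, and log(A e^{nα}).
  refine ⟨3 * C, by linarith, N + 3, fun n hn x hx t ht η hη hη' => ?_⟩
  obtain ⟨-, -, h1, h1A⟩ := h n (by omega) x hx
  have hn0 : (0 : ℝ) < n := by exact_mod_cast (by omega : 0 < n)
  have hn1 : (1 : ℝ) ≤ n := by exact_mod_cast (by omega : 1 ≤ n)
  have hlog : 1 ≤ Real.log n := by
    rw [Real.le_log_iff_exp_le hn0]
    have : (3 : ℝ) ≤ n := by exact_mod_cast (by omega : 3 ≤ n)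
    linarith [Real.exp_one_lt_d9]
  have hη0 : 0 < η := lt_of_lt_of_le (by positivity) hη
  obtain ⟨h2, h3, -⟩ := h1 t ht η hη0
  have h3 := h3 hη
  obtain ⟨hA, h4⟩ := h1A t ht
  rw [Real.log_mul hA.ne' (Real.exp_pos _).ne', Real.log_exp] at h4
  rw [← log_norm_nodePolyC hη0] at h2
  have h5 : n * η ^ 3 ≤ 1 := by
    calc n * η ^ 3 ≤ (n : ℝ) * ((n : ℝ) ^ (-0.4 : ℝ)) ^ 3 := by gcongr
      _ = (n : ℝ) ^ (1 : ℝ) * (n : ℝ) ^ (-0.4 * (3 : ℕ) : ℝ) := by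
        rw [Real.rpow_mul_natCast hn0.le, Real.rpow_one]
      _ = (n : ℝ) ^ (-0.2 : ℝ) := by rw [← Real.rpow_add hn0]; norm_num
      _ ≤ 1 := Real.rpow_le_one_of_one_le_of_nonpos hn1 (by norm_num)
  have h6 : C * n * η ^ 3 ≤ C * Real.log n := by
    rw [mul_assoc]; gcongr; linarith
  have hP := norm_nodePolyC_pos hη0 x t
  rw [abs_le] at h2 h3 h4
  rw [Real.rpow_def_of_pos hn0, Real.rpow_def_of_pos hn0]
  nth_rewrite 1 [← Real.exp_log hA]
  rw [← Real.exp_log hP]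
  nth_rewrite 2 [← Real.exp_log hA]
  rw [← Real.exp_add, ← Real.exp_add, ← Real.exp_add, ← Real.exp_add, Real.exp_le_exp,
    Real.exp_le_exp]
  constructor
  · linarith [h2.1, h3.1, h4.2]
  · linarith [h2.2, h3.2, h4.1]

lemma tendsto_natCast_rpow_neg {r : ℝ} (hr : 0 < r) :
    Tendsto (fun n : ℕ => (n : ℝ) ^ (-r)) atTop (𝓝 0) :=
  (tendsto_rpow_neg_atTop hr).comp tendsto_natCast_atTop_atTop

lemma exp_le_one_add_two_mul {u : ℝ} (h0 : 0 ≤ u) (h1 : u ≤ 1) : Real.exp u ≤ 1 + 2 * u := by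
  have h := Real.abs_exp_sub_one_le (x := u) (by rwa [abs_of_nonneg h0])
  rw [abs_of_nonneg h0] at h
  linarith [le_abs_self (Real.exp u - 1)]

/-- The sharp upper bound for the node polynomial close to the interval. -/
theorem norm_nodePolyC_le (a b K B : ℝ) (ha : -1 ≤ a) (hab : a < b) (hb : b ≤ 1)
    {a' b' : ℝ} (ha' : a < a') (hb' : b' < b) :
    ∃ C : ℝ, 1 ≤ C ∧ ∃ N : ℕ, ∀ n : ℕ, N ≤ n → ∀ x : Fin n → ℝ, GoodNodes a b K B x →
      ∀ t ∈ Icc a' b', ∀ η : ℝ, 0 ≤ η → η ≤ (n : ℝ) ^ (-0.4 : ℝ) →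
        ‖nodePolyC x (t + η * Complex.I)‖ ≤
          (1 + C * (n : ℝ) ^ (-0.1 : ℝ)) * amplitude a b x t *
            Real.exp (π * n * η * rho a b x t * (1 + C * (n : ℝ) ^ (-0.1 : ℝ))) := by
  obtain ⟨C, hC, N, h⟩ := density_estimates a b K B ha hab hb ha' hb'
  obtain ⟨N₁, hN₁⟩ := eventually_atTop.1 ((tendsto_natCast_rpow_neg (r := 0.1)
    (by norm_num)).eventually_le_const (show (0 : ℝ) < 1 / (2 * C + 1) by positivity))
  have hlog9 : Tendsto (fun n : ℕ => Real.log n / (n : ℝ) ^ (0.9 : ℝ)) atTop (𝓝 0) :=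
    (isLittleO_log_rpow_atTop (r := 0.9) (by norm_num)).tendsto_div_nhds_zero.comp
      tendsto_natCast_atTop_atTop
  obtain ⟨N₂, hN₂⟩ := eventually_atTop.1 (hlog9.eventually_le_const one_pos)
  set C' := 2 * C + 1 with hC'
  refine ⟨2 * C' + C' * C, by nlinarith, N + N₁ + N₂ + 3, fun n hn x hx t ht η hη hη' => ?_⟩
  obtain ⟨hρ, -, h1, h1A⟩ := h n (by omega) x hx
  have hn0 : (0 : ℝ) < n := by exact_mod_cast (by omega : 0 < n)
  have hn1 : (1 : ℝ) ≤ n := by exact_mod_cast (by omega : 1 ≤ n)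
  have hq1 := hN₁ n (by omega)
  have hlq := hN₂ n (by omega)
  rw [show (-0.1 : ℝ) = -(0.1 : ℝ) by norm_num]
  set q := (n : ℝ) ^ (-(0.1 : ℝ)) with hq
  have hq0 : 0 < q := by positivity
  obtain ⟨hA, -⟩ := h1A t ht
  have hC'0 : 0 < C' := by linarith
  -- Poisson's formula needs η > 0; on the real axis the bound |P| ≤ A is used directly.
  rcases hη.eq_or_lt with rfl | hη0
  · have h2 := abs_eval_le_amplitude x (t := t) (a := a) (b := b)
      ⟨by linarith [ht.1], by linarith [ht.2]⟩
    simp only [Complex.ofReal_zero, zero_mul, add_zero, mul_zero, Real.exp_zero, mul_one]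
    rw [nodePolyC_ofReal, Complex.norm_real, Real.norm_eq_abs]
    refine h2.trans (le_mul_of_one_le_left hA.le ?_)
    have : 0 ≤ (2 * C' + C' * C) * q := by positivity
    linarith
  obtain ⟨h2, -, h3⟩ := h1 t ht η hη0
  rw [Real.log_mul hA.ne' (Real.exp_pos _).ne', Real.log_exp] at h3
  rw [← log_norm_nodePolyC hη0] at h2
  have e1 : η ^ 2 ≤ q := by
    calc η ^ 2 ≤ ((n : ℝ) ^ (-0.4 : ℝ)) ^ 2 := by gcongr
      _ = (n : ℝ) ^ (-0.4 * (2 : ℕ) : ℝ) := (Real.rpow_mul_natCast hn0.le _ _).symm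
      _ ≤ q := Real.rpow_le_rpow_of_exponent_le hn1 (by norm_num)
  -- The 1 will go into the prefactor and the nη into the exponent.
  have e2 : (n : ℝ) ^ (0.1 : ℝ) * √η ≤ q * (1 + n * η) := by
    have e3 : (n : ℝ) ^ (0.1 : ℝ) = q * (n : ℝ) ^ (0.2 : ℝ) := by
      rw [hq, ← Real.rpow_add hn0]; norm_num
    have e4 : (n : ℝ) ^ (0.2 : ℝ) ≤ √n := by
      rw [Real.sqrt_eq_rpow]
      exact Real.rpow_le_rpow_of_exponent_le hn1 (by norm_num)
    rw [e3, mul_assoc]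
    gcongr
    calc (n : ℝ) ^ (0.2 : ℝ) * √η ≤ √n * √η := by gcongr
      _ = √(n * η) := (Real.sqrt_mul hn0.le η).symm
      _ ≤ 1 + n * η := by
        rw [Real.sqrt_le_left (by positivity)]
        nlinarith [mul_pos hn0 hη0]
  have e3 : Real.log n ≤ n * q := by
    rw [div_le_one (by positivity)] at hlq
    refine hlq.trans (le_of_eq ?_)
    rw [hq]
    nth_rewrite 2 [← Real.rpow_one (n : ℝ)]
    rw [← Real.rpow_add hn0]; norm_num
  have e4 : Real.log ‖nodePolyC x (t + η * Complex.I)‖ ≤ Real.log (amplitude a b x t) +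
      π * n * η * rho a b x t + C' * q * (1 + n * η) := by
    have e5 : C * n * η ^ 3 ≤ C * q * (n * η) := by
      calc C * n * η ^ 3 = C * (n * η) * η ^ 2 := by ring
        _ ≤ C * (n * η) * q := by gcongr
        _ = _ := by ring
    have e6 : C * Real.log n * η ≤ C * q * (n * η) := by
      calc _ ≤ C * (n * q) * η := by gcongr
        _ = _ := by ring
    have e7 : 0 ≤ C * q := by positivity
    rw [hC']
    linarith [(abs_le.1 h2).2]
  have hρt := (hρ t ht).1
  have hρ0 : 0 < rho a b x t := lt_of_lt_of_le (by positivity) hρt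
  have hCρ : 1 ≤ C * rho a b x t := by
    rw [inv_le_iff_one_le_mul₀ (by linarith)] at hρt
    linarith
  have e8 : C' * q ≤ 1 := by
    rw [le_div_iff₀ hC'0] at hq1
    linarith
  rw [← Real.exp_log (norm_nodePolyC_pos hη0 x t)]
  calc _ ≤ Real.exp (C' * q + Real.log (amplitude a b x t) +
        (π * n * η * rho a b x t + C' * q * (n * η))) := Real.exp_le_exp.2 (by linarith)
    _ = Real.exp (C' * q) * amplitude a b x t *
        Real.exp (π * n * η * rho a b x t + C' * q * (n * η)) := by
        rw [Real.exp_add, Real.exp_add, Real.exp_log hA]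
    _ ≤ _ := by
      gcongr
      · refine (exp_le_one_add_two_mul (by positivity) e8).trans ?_
        have : 0 ≤ C' * C * q := by positivity
        linarith
      -- As ρ ≥ 1/C, the additive error C'q·nη becomes a relative error in πnηρ.
      · rw [mul_add, mul_one]
        refine add_le_add le_rfl ?_
        have e9 : 1 ≤ π * (C * rho a b x t) := by nlinarith [Real.pi_gt_three]
        have e10 : C' * q * (n * η) ≤ C' * q * (n * η) * (π * (C * rho a b x t)) :=
          le_mul_of_one_le_right (by positivity) e9
        have e11 : 0 ≤ π * n * η * rho a b x t * (2 * C' * q) := by positivity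
        linarith

end

/-! ### The derivative bound and assembly. -/

lemma one_add_mul_mul_one_add_mul_le {u v q : ℝ} (hu : 0 ≤ u) (hv : 0 ≤ v) (hq : 0 ≤ q)
    (hq1 : q ≤ 1) : (1 + u * q) * (1 + v * q) ≤ 1 + (u + v + u * v) * q := by
  have : u * v * (q * q) ≤ u * v * q := by
    gcongr
    nlinarith
  nlinarith

lemma hasDerivAt_nodePolyC {n : ℕ} (x : Fin n → ℝ) (t : ℝ) :
    HasDerivAt (fun z : ℂ => nodePolyC x (t + z))
      (((nodePoly x).derivative.eval t : ℝ) : ℂ) 0 := by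
  have h : HasDerivAt (fun z : ℂ => nodePolyC x z)
      (Polynomial.aeval (t : ℂ) (nodePoly x).derivative) ((t : ℂ) + 0) := by
    rw [add_zero]
    exact Polynomial.hasDerivAt_aeval (nodePoly x) (t : ℂ)
  have h2 : Polynomial.aeval (t : ℂ) (nodePoly x).derivative =
      (((nodePoly x).derivative.eval t : ℝ) : ℂ) := by
    rw [← Complex.coe_algebraMap, Polynomial.aeval_algebraMap_apply, Polynomial.coe_aeval_eq_eval]
  rw [h2] at h
  exact h.comp_const_add (t : ℂ) 0

lemma differentiable_nodePolyC {n : ℕ} (x : Fin n → ℝ) (t : ℝ) :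
    Differentiable ℂ (fun z : ℂ => nodePolyC x (t + z)) := by
  simp_rw [nodePolyC_eq]
  fun_prop

set_option maxHeartbeats 1000000 in
/-- The sharp bound for the derivative of the node polynomial. -/
theorem abs_derivative_le (a b K B : ℝ) (ha : -1 ≤ a) (hab : a < b) (hb : b ≤ 1)
    {a' b' : ℝ} (ha' : a < a') (hb' : b' < b) :
    ∃ C : ℝ, 1 ≤ C ∧ ∃ N : ℕ, ∀ n : ℕ, N ≤ n → ∀ x : Fin n → ℝ, GoodNodes a b K B x →
      ∀ t ∈ Icc a' b', |(nodePoly x).derivative.eval t| ≤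
        (1 + C * (n : ℝ) ^ (-0.1 : ℝ)) * π * n * amplitude a b x t * rho a b x t := by
  -- Discs about points of I' stray outside it, so the estimates are taken on an intermediate
  -- interval.
  set a'' := (a + a') / 2 with ha''
  set b'' := (b' + b) / 2 with hb''
  obtain ⟨C₁, hC₁, N₁, h₁⟩ := density_estimates a b K B ha hab hb
    (show a < a'' by linarith) (show b'' < b by linarith)
  obtain ⟨C₂, hC₂, N₂, h₂⟩ := norm_nodePolyC_le a b K B ha hab hb
    (show a < a'' by linarith) (show b'' < b by linarith)
  set δ := min (a' - a'') (b'' - b') with hδ_def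
  have hδ : 0 < δ := lt_min (by linarith) (by linarith)
  obtain ⟨N₃, hN₃⟩ := eventually_atTop.1 ((tendsto_natCast_rpow_neg (r := 0.5)
    (by norm_num)).eventually_le_const hδ)
  obtain ⟨N₄, hN₄⟩ := eventually_atTop.1 ((tendsto_natCast_rpow_neg (r := 0.5)
    (by norm_num)).eventually_le_const (show (0 : ℝ) < 1 / (2 * C₁) by positivity))
  -- Each constant merges two factors 1 + O(q). `D`: variation of ρ and the exponent error in (v).
  -- `D₁`: the prefactor error in (v) and variation of A. `D₂`: `D` and the Bernstein loss 4/m.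
  set D := C₁ ^ 2 + C₂ + C₁ ^ 2 * C₂ with hD
  have hD0 : 0 ≤ D := by positivity
  set D₁ := C₂ + 2 + C₂ * 2 with hD₁
  have hD₁0 : 0 ≤ D₁ := by positivity
  set D₂ := D + 8 * C₁ + D * (8 * C₁) with hD₂
  have hD₂0 : 0 ≤ D₂ := by positivity
  refine ⟨D₁ + D₂ + D₁ * D₂, by nlinarith [mul_nonneg hD₁0 hD₂0], N₁ + N₂ + N₃ + N₄ + 1,
    fun n hn x hx t ht => ?_⟩
  have hn0 : (0 : ℝ) < n := by exact_mod_cast (by omega : 0 < n)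
  have hn1 : (1 : ℝ) ≤ n := by exact_mod_cast (by omega : 1 ≤ n)
  obtain ⟨hρ, hρL, -, hA⟩ := h₁ n (by omega) x hx
  have hP := h₂ n (by omega) x hx
  have hrδ := hN₃ n (by omega)
  have hrC := hN₄ n (by omega)
  rw [show (-0.1 : ℝ) = -(0.1 : ℝ) by norm_num] at hP ⊢
  set q := (n : ℝ) ^ (-(0.1 : ℝ)) with hq
  -- The disc radius: below n^{-0.4}, so (v) applies, and small enough that A and ρ vary by factors
  -- 1 + O(q); yet nr = n^{1/2} is large, so the disc holds many half-periods.
  set r := (n : ℝ) ^ (-(0.5 : ℝ)) with hr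
  have hq0 : 0 < q := by positivity
  have hr0 : 0 < r := by positivity
  have hq1 : q ≤ 1 := Real.rpow_le_one_of_one_le_of_nonpos hn1 (by norm_num)
  have hrq : r ≤ q := Real.rpow_le_rpow_of_exponent_le hn1 (by norm_num)
  have hr4 : r ≤ (n : ℝ) ^ (-0.4 : ℝ) := Real.rpow_le_rpow_of_exponent_le hn1 (by norm_num)
  have hnr : (n : ℝ) ^ (0.1 : ℝ) * r ≤ q := by
    rw [hr, ← Real.rpow_add hn0]
    exact Real.rpow_le_rpow_of_exponent_le hn1 (by norm_num)
  have hnrr : n * r * r = 1 := by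
    rw [hr, mul_assoc, ← Real.rpow_add hn0]
    nth_rewrite 1 [← Real.rpow_one (n : ℝ)]
    rw [← Real.rpow_add hn0]; norm_num
  have ht'' : t ∈ Icc a'' b'' := ⟨by linarith [ht.1], by linarith [ht.2]⟩
  obtain ⟨hρt, -⟩ := hρ t ht''
  have hAt := (hA t ht'').1
  set R := rho a b x t with hR
  have hR0 : 0 < R := lt_of_lt_of_le (by positivity) hρt
  have hCR : 1 ≤ C₁ * R := by
    rw [inv_le_iff_one_le_mul₀ (by linarith)] at hρt
    linarith
  have hpi := Real.pi_pos
  set σ := π * n * R * (1 + D * q) with hσ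
  have hσ0 : 0 < σ := by positivity
  set M := (1 + D₁ * q) * amplitude a b x t with hM
  set m := ⌊σ * r / π⌋₊ with hm
  have hσr : n * r / C₁ ≤ σ * r / π := by
    rw [div_le_div_iff₀ (by linarith) hpi, hσ]
    have h1 : 0 ≤ D * q := by positivity
    calc n * r * π = π * n * r * 1 := by ring
      _ ≤ π * n * r * ((C₁ * R) * (1 + D * q)) := by
        gcongr; nlinarith
      _ = _ := by ring
  -- With this, rounding down to m loses at most half, so 4/m = O(r).
  have hnr2 : 2 ≤ n * r / C₁ := by
    rw [le_div_iff₀ (by positivity)] at hrC ⊢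
    have : r * (2 * C₁) * (n * r) ≤ 1 * (n * r) := by gcongr
    nlinarith
  have hm1 : σ * r / π - 1 < m := Nat.sub_one_lt_floor _
  have hm2 : n * r / C₁ / 2 ≤ m := by linarith
  have hm0 : 1 ≤ m := by
    have : (1 : ℝ) ≤ m := by linarith
    exact_mod_cast this
  have hmr : m * π / σ ≤ r := by
    have : (m : ℝ) ≤ σ * r / π := Nat.floor_le (by positivity)
    rw [le_div_iff₀ hpi] at this
    rw [div_le_iff₀ hσ0]
    linarith
  have hupper : ∀ s ∈ Icc a'' b'', |t - s| ≤ r → ∀ η : ℝ, 0 ≤ η → η ≤ r →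
      ‖nodePolyC x (s + η * Complex.I)‖ ≤ M * Real.exp (σ * η) := by
    intro s hs hts η hη hηr
    have h3 := hP s hs η hη (hηr.trans hr4)
    have h4 : amplitude a b x s ≤ (1 + 2 * q) * amplitude a b x t := by
      refine (amplitude_le_exp_mul_amplitude hab.le x s t).trans ?_
      gcongr
      refine (Real.exp_le_exp.2 ?_).trans (exp_le_one_add_two_mul hq0.le hq1)
      rw [abs_sub_comm]
      exact (mul_le_mul_of_nonneg_left hts (by positivity)).trans hnr
    have h5 : rho a b x s ≤ R * (1 + C₁ ^ 2 * q) := by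
      have h6 := (le_abs_self _).trans (hρL s hs t ht'')
      rw [abs_sub_comm] at h6
      have h7 : C₁ * |t - s| ≤ C₁ * q := by gcongr; linarith
      have h8 : C₁ * q ≤ C₁ * q * (C₁ * R) := le_mul_of_one_le_right (by positivity) hCR
      nlinarith
    refine h3.trans ?_
    refine mul_le_mul ?_ (Real.exp_le_exp.2 ?_) (Real.exp_pos _).le (by positivity)
    · calc _ ≤ (1 + C₂ * q) * ((1 + 2 * q) * amplitude a b x t) := by gcongr
        _ = (1 + C₂ * q) * (1 + 2 * q) * amplitude a b x t := by ring
        _ ≤ M := by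
          rw [hM]
          gcongr
          exact one_add_mul_mul_one_add_mul_le (by linarith) (by norm_num) hq0.le hq1
    · calc π * n * η * rho a b x s * (1 + C₂ * q) ≤
            π * n * η * (R * (1 + C₁ ^ 2 * q)) * (1 + C₂ * q) := by gcongr
        _ = π * n * R * η * ((1 + C₁ ^ 2 * q) * (1 + C₂ * q)) := by ring
        _ ≤ π * n * R * η * (1 + D * q) := by
          gcongr
          exact one_add_mul_mul_one_add_mul_le (by positivity) (by linarith) hq0.le hq1
        _ = _ := by rw [hσ]; ring
  have hbern := norm_deriv_le_of_local_exponential_type (differentiable_nodePolyC x t) hm0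
    (M := M) hσ0 (by
      intro z hz
      have hzr := hz.trans hmr
      have hre := (Complex.abs_re_le_norm z).trans hzr
      have him := (Complex.abs_im_le_norm z).trans hzr
      have hreδ := hre.trans hrδ
      have h1 : δ ≤ a' - a'' := min_le_left _ _
      have h2 : δ ≤ b'' - b' := min_le_right _ _
      have hs : t + z.re ∈ Icc a'' b'' :=
        ⟨by linarith [ht.1, (abs_le.1 hreδ).1], by linarith [ht.2, (abs_le.1 hreδ).2]⟩
      have h3 := hupper (t + z.re) hs (by simpa using hre) |z.im| (abs_nonneg _) him
      refine le_trans (le_of_eq ?_) h3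
      -- Real nodes make |P| symmetric under conjugation, which reduces to the upper half-plane.
      rcases abs_cases z.im with ⟨h, -⟩ | ⟨h, -⟩
      · rw [h]
        congr 2
        conv_lhs => rw [← Complex.re_add_im z]
        push_cast; ring
      · rw [h, ← norm_nodePolyC_neg]
        congr 2
        conv_lhs => rw [← Complex.re_add_im z]
        push_cast; ring)
  rw [(hasDerivAt_nodePolyC x t).deriv, Complex.norm_real, Real.norm_eq_abs] at hbern
  have hm4 : 4 / (m : ℝ) ≤ 8 * C₁ * q := by
    calc 4 / (m : ℝ) ≤ 4 / (n * r / C₁ / 2) := by gcongr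
      _ = 8 * C₁ * r := by
        have : (n : ℝ) * r ≠ 0 := by positivity
        field_simp
        linarith
      _ ≤ _ := by gcongr
  calc _ ≤ M * σ * (1 + 4 / m) := hbern
    _ ≤ M * σ * (1 + 8 * C₁ * q) := by gcongr
    _ = (1 + D₁ * q) * ((1 + D * q) * (1 + 8 * C₁ * q)) * (π * n * amplitude a b x t * R) := by
      rw [hM, hσ]; ring
    _ ≤ (1 + D₁ * q) * (1 + D₂ * q) * (π * n * amplitude a b x t * R) := by
      gcongr
      exact one_add_mul_mul_one_add_mul_le hD0 (by positivity) hq0.le hq1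
    _ ≤ (1 + (D₁ + D₂ + D₁ * D₂) * q) * (π * n * amplitude a b x t * R) := by
      gcongr
      exact one_add_mul_mul_one_add_mul_le hD₁0 hD₂0 hq0.le hq1
    _ = _ := by ring

/-- The estimates on a compact subinterval of the interior. -/
theorem interior_estimates (a b K B : ℝ) (ha : -1 ≤ a) (hab : a < b) (hb : b ≤ 1)
    {a' b' : ℝ} (ha' : a < a') (hb' : b' < b) :
    ∃ C : ℝ, 0 < C ∧ ∃ N : ℕ, ∀ n : ℕ, N ≤ n → ∀ x : Fin n → ℝ, GoodNodes a b K B x →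
      (∀ t ∈ Set.Icc a' b', C⁻¹ ≤ rho a b x t ∧ rho a b x t ≤ C) ∧
      (∀ s ∈ Set.Icc a' b', ∀ t ∈ Set.Icc a' b',
        |rho a b x s - rho a b x t| ≤ C * |s - t|) ∧
      (∀ t ∈ Set.Icc a' b', ∀ η : ℝ, Real.log n / n ≤ η →
        |logPotential x (t + η * Complex.I) - (alpha x - Real.pi * η * rho a b x t)| ≤
            C * (Real.log n / n + η ^ 3) ∧
          |logPotential x (t - η * Complex.I) - (alpha x - Real.pi * η * rho a b x t)| ≤
            C * (Real.log n / n + η ^ 3)) ∧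
      (∀ t ∈ Set.Icc a' b', ∀ η : ℝ, 0 ≤ η → η ≤ (n : ℝ) ^ (-0.4 : ℝ) →
        ‖nodePolyC x (t + η * Complex.I)‖ ≤
          (1 + C * (n : ℝ) ^ (-0.1 : ℝ)) * amplitude a b x t *
            Real.exp (Real.pi * n * η * rho a b x t * (1 + C * (n : ℝ) ^ (-0.1 : ℝ)))) ∧
      (∀ t ∈ Set.Icc a' b', ∀ η : ℝ, Real.log n / n ≤ η → η ≤ (n : ℝ) ^ (-0.4 : ℝ) →
        (n : ℝ) ^ (-C) * amplitude a b x t * Real.exp (Real.pi * n * η * rho a b x t) ≤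
            ‖nodePolyC x (t + η * Complex.I)‖ ∧
          ‖nodePolyC x (t + η * Complex.I)‖ ≤
            (n : ℝ) ^ C * amplitude a b x t * Real.exp (Real.pi * n * η * rho a b x t)) ∧
      (∀ t ∈ Set.Icc a' b',
        |(nodePoly x).derivative.eval t| ≤
          (1 + C * (n : ℝ) ^ (-0.1 : ℝ)) * Real.pi * n * amplitude a b x t * rho a b x t) := by
  obtain ⟨C₁, hC₁, N₁, h₁⟩ := density_estimates a b K B ha hab hb ha' hb'
  obtain ⟨C₂, hC₂, N₂, h₂⟩ := logPotential_estimate a b K B ha hab hb ha' hb'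
  obtain ⟨C₃, hC₃, N₃, h₃⟩ := norm_nodePolyC_le a b K B ha hab hb ha' hb'
  obtain ⟨C₄, hC₄, N₄, h₄⟩ := norm_nodePolyC_two_sided a b K B ha hab hb ha' hb'
  obtain ⟨C₅, hC₅, N₅, h₅⟩ := abs_derivative_le a b K B ha hab hb ha' hb'
  refine ⟨C₁ + C₂ + C₃ + C₄ + C₅, by linarith, N₁ + N₂ + N₃ + N₄ + N₅ + 1, fun n hn x hx => ?_⟩
  set C := C₁ + C₂ + C₃ + C₄ + C₅ with hC
  have hn1 : (1 : ℝ) ≤ n := by exact_mod_cast (by omega : 1 ≤ n)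
  have hn0 : (0 : ℝ) < n := by linarith
  have hlog := Real.log_nonneg hn1
  obtain ⟨hρ, hρL, -, hA⟩ := h₁ n (by omega) x hx
  have hρ0 : ∀ t ∈ Icc a' b', 0 < rho a b x t := fun t ht =>
    lt_of_lt_of_le (by positivity) (hρ t ht).1
  have hU : ∀ t ∈ Icc a' b', ∀ η : ℝ, Real.log n / n ≤ η →
      |logPotential x (t + η * Complex.I) - (alpha x - π * η * rho a b x t)| ≤
        C * (Real.log n / n + η ^ 3) := fun t ht η hη => by
    have hη0 : 0 ≤ η := le_trans (by positivity) hη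
    refine (h₂ n (by omega) x hx t ht η hη).trans ?_
    gcongr
    linarith
  refine ⟨fun t ht => ⟨?_, (hρ t ht).2.trans (by linarith)⟩, fun s hs t ht => ?_,
    fun t ht η hη => ⟨hU t ht η hη, ?_⟩, fun t ht η hη hη' => ?_, fun t ht η hη hη' => ⟨?_, ?_⟩,
    fun t ht => ?_⟩
  · exact (inv_anti₀ (by linarith) (by linarith)).trans (hρ t ht).1
  · exact (hρL s hs t ht).trans (by gcongr; linarith)
  · rw [logPotential_neg]
    exact hU t ht η hη
  · have h0 := hρ0 t ht
    have h1 := (hA t ht).1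
    have h2 : C₃ ≤ C := by linarith
    refine (h₃ n (by omega) x hx t ht η hη hη').trans ?_
    gcongr
  · have h1 := (hA t ht).1
    refine le_trans ?_ (h₄ n (by omega) x hx t ht η hη hη').1
    have : (n : ℝ) ^ (-C) ≤ (n : ℝ) ^ (-C₄) :=
      Real.rpow_le_rpow_of_exponent_le hn1 (by linarith)
    gcongr
  · have h1 := (hA t ht).1
    refine (h₄ n (by omega) x hx t ht η hη hη').2.trans ?_
    have : (n : ℝ) ^ C₄ ≤ (n : ℝ) ^ C := Real.rpow_le_rpow_of_exponent_le hn1 (by linarith)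
    gcongr
  · have h0 := hρ0 t ht
    have h1 := (hA t ht).1
    have h2 : C₅ ≤ C := by linarith
    refine (h₅ n (by omega) x hx t ht).trans ?_
    gcongr

end LagrangeInterp

theorem mainTheorem7 (a b K B : ℝ) (ha : -1 ≤ a) (hab : a < b) (hb : b ≤ 1) :
    -- Estimates on all of `I = [a, b]`; `C` and `N` depend only on `I`, `K`, `B`.
    (∃ C : ℝ, 0 < C ∧ ∃ N : ℕ, ∀ n : ℕ, N ≤ n → ∀ x : Fin n → ℝ,
      LagrangeInterp.GoodNodes a b K B x →
        -- the defining bounds of `α`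
        |LagrangeInterp.alpha x| ≤ C ∧
        (∀ t ∈ Set.Icc a b,
          LagrangeInterp.nodeDist x t * Real.exp (-(n * LagrangeInterp.alpha x)) ≤
              |(LagrangeInterp.nodePoly x).eval t| ∧
            |(LagrangeInterp.nodePoly x).eval t| ≤
              C * (n : ℝ) ^ C * Real.exp (-(n * LagrangeInterp.alpha x))) ∧
        -- (i) domination by amplitude
        (∀ t ∈ Set.Icc a b,
          |(LagrangeInterp.nodePoly x).eval t| ≤ LagrangeInterp.amplitude a b x t) ∧
        -- (ii) log-Lipschitz property
        (∀ s ∈ Set.Icc a b, ∀ t ∈ Set.Icc a b,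
          Real.exp (-((n : ℝ) ^ (0.1 : ℝ) * |s - t|)) * LagrangeInterp.amplitude a b x t ≤
              LagrangeInterp.amplitude a b x s ∧
            LagrangeInterp.amplitude a b x s ≤
              Real.exp ((n : ℝ) ^ (0.1 : ℝ) * |s - t|) * LagrangeInterp.amplitude a b x t) ∧
        -- (iii) amplitude size
        (∀ t ∈ Set.Icc a b,
          (n : ℝ) ^ (-C) * Real.exp (-(n * LagrangeInterp.alpha x)) ≤
              LagrangeInterp.amplitude a b x t ∧
            LagrangeInterp.amplitude a b x t ≤
              (n : ℝ) ^ C * Real.exp (-(n * LagrangeInterp.alpha x))) ∧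
        -- (iv) location of the extremizer
        (∀ t ∈ Set.Icc a b, ∃ s ∈ Set.Icc a b,
          |t - s| ≤ C * (Real.log n / (n : ℝ) ^ (0.1 : ℝ)) ∧
          LagrangeInterp.amplitude a b x t =
            |(LagrangeInterp.nodePoly x).eval s| *
              Real.exp (-((n : ℝ) ^ (0.1 : ℝ) * |t - s|)) ∧
          LagrangeInterp.amplitude a b x t =
            LagrangeInterp.amplitude a b x s *
              Real.exp (-((n : ℝ) ^ (0.1 : ℝ) * |t - s|)))) ∧
    -- Estimates on `I' = [a', b']` inside the interior of `I`; `C` and `N` may depend on `I'` too.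
    (∀ a' b' : ℝ, a < a' → a' < b' → b' < b →
      ∃ C : ℝ, 0 < C ∧ ∃ N : ℕ, ∀ n : ℕ, N ≤ n → ∀ x : Fin n → ℝ,
        LagrangeInterp.GoodNodes a b K B x →
          -- the defining bounds of `ρ`
          (∀ t ∈ Set.Icc a' b',
            C⁻¹ ≤ LagrangeInterp.rho a b x t ∧ LagrangeInterp.rho a b x t ≤ C) ∧
          (∀ s ∈ Set.Icc a' b', ∀ t ∈ Set.Icc a' b',
            |LagrangeInterp.rho a b x s - LagrangeInterp.rho a b x t| ≤ C * |s - t|) ∧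
          (∀ t ∈ Set.Icc a' b', ∀ η : ℝ, Real.log n / n ≤ η →
            |LagrangeInterp.logPotential x (t + η * Complex.I) -
                (LagrangeInterp.alpha x - Real.pi * η * LagrangeInterp.rho a b x t)| ≤
                C * (Real.log n / n + η ^ 3) ∧
              |LagrangeInterp.logPotential x (t - η * Complex.I) -
                (LagrangeInterp.alpha x - Real.pi * η * LagrangeInterp.rho a b x t)| ≤
                C * (Real.log n / n + η ^ 3)) ∧
          -- (v) bounds in the upper half-plane
          (∀ t ∈ Set.Icc a' b', ∀ η : ℝ, 0 ≤ η → η ≤ (n : ℝ) ^ (-0.4 : ℝ) →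
            ‖LagrangeInterp.nodePolyC x (t + η * Complex.I)‖ ≤
              (1 + C * (n : ℝ) ^ (-0.1 : ℝ)) * LagrangeInterp.amplitude a b x t *
                Real.exp (Real.pi * n * η * LagrangeInterp.rho a b x t *
                  (1 + C * (n : ℝ) ^ (-0.1 : ℝ)))) ∧
          (∀ t ∈ Set.Icc a' b', ∀ η : ℝ, Real.log n / n ≤ η → η ≤ (n : ℝ) ^ (-0.4 : ℝ) →
            (n : ℝ) ^ (-C) * LagrangeInterp.amplitude a b x t *
                Real.exp (Real.pi * n * η * LagrangeInterp.rho a b x t) ≤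
                ‖LagrangeInterp.nodePolyC x (t + η * Complex.I)‖ ∧
              ‖LagrangeInterp.nodePolyC x (t + η * Complex.I)‖ ≤
                (n : ℝ) ^ C * LagrangeInterp.amplitude a b x t *
                  Real.exp (Real.pi * n * η * LagrangeInterp.rho a b x t)) ∧
          -- (vi) derivative bound
          (∀ t ∈ Set.Icc a' b',
            |(LagrangeInterp.nodePoly x).derivative.eval t| ≤
              (1 + C * (n : ℝ) ^ (-0.1 : ℝ)) * Real.pi * n *
                LagrangeInterp.amplitude a b x t * LagrangeInterp.rho a b x t)) := by
  exact ⟨LagrangeInterp.amplitude_estimates a b K B ha hab hb, fun _ _ ha' _ hb' =>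
    LagrangeInterp.interior_estimates a b K B ha hab hb ha' hb'⟩
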